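/- Let $\Gamma$ be a connected finite metric graph (loops and multiple edges allowed) whose edges are segments of positive finite length, with the Schrödinger operator $H f=-f''+Vf$ on it, where $V$ is real, bounded and piecewise continuous on each edge. The domain of $H$ consists of the functions $f$ that belong to $H^2(e)$ on every edge $e$, are continuous at the vertices, and satisfy at every vertex $v$ a $\delta$-type condition $\sum_{e\ni v}\frac{df}{dx_e}(v)=\alpha_v f(v)$ with $\alpha_v\in\mathbb R$ (derivatives taken into the edge, away from $v$) or the Dirichlet condition $f(v)=0$ (written $\alpha_v=\infty$). A Dirichlet vertex is understood as cutting the graph at that vertex, and connectedness is understood after this cutting; in particular it is the usual connectedness if the Dirichlet vertices have degree one. A proper $m$-partition $P$ of $\Gamma$ is a set of $m$ distinct points in the interiors of edges of $\Gamma$. Imposing the Dirichlet condition at the points of $P$ separates $\Gamma$ into connected subgraphs $\Gamma_j$; let $\lambda_1(\Gamma_j)$ be the lowest eigenvalue of $H$ on $\Gamma_j$ (with the Dirichlet condition at the partition points and the original conditions at the vertices of $\Gamma$), and put $\Lambda(P)=\max_j\lambda_1(\Gamma_j)$. The $\varepsilon$-neighborhood of $P$ is the set of proper $m$-partitions obtained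 by moving each point of $P$ along its edge by a distance smaller than $\varepsilon$. Theorem. If $P$ is a local minimum of $\Lambda$ on the set of proper $m$-partitions of $\Gamma$, that is, if for some $\varepsilon>0$ we have $\Lambda(P)\le\Lambda(P')$ for every $P'$ in the $\varepsilon$-neighborhood of $P$, then $P$ is an equipartition: $\lambda_1(\Gamma_i)=\lambda_1(\Gamma_j)$ for all $i,j$. -/

import Mathlib

open MeasureTheory Set

/-- A quantum graph with vertices `V` and edges `E` (loops and multiple edges are allowed).
The edge `e` is a segment of positive finite length `hi e - lo e` joining `src e` to `tgt e`,
with arc length coordinate running from `lo e` (at `src e`) to `hi e` (at `tgt e`).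
The Hamiltonian is `f ↦ -f'' + pot f`, with the `δ`-type condition of coefficient `coupling v`
at the vertex `v`; the value `⊤` stands for the Dirichlet condition. -/
structure QuantumGraph (V E : Type*) where
  /-- initial vertex of an edge -/
  src : E → V
  /-- terminal vertex of an edge -/
  tgt : E → V
  /-- coordinate of the initial end -/
  lo : E → ℝ
  /-- coordinate of the terminal end -/
  hi : E → ℝ
  lo_lt_hi : ∀ e, lo e < hi e
  /-- the potential along the edges -/
  pot : E → ℝ → ℝ
  pot_bounded : ∀ e, ∃ M : ℝ, ∀ x ∈ Icc (lo e) (hi e), |pot e x| ≤ M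
  pot_piecewise : ∀ e, ∃ S : Finset ℝ, ContinuousOn (pot e) (Icc (lo e) (hi e) \ (S : Set ℝ))
  /-- the coefficient of the vertex condition -/
  coupling : V → WithTop ℝ

/-- `f` belongs to the Sobolev space `H²(a, b)` with first derivative `f'` and second
derivative `f''`: `f` is `C¹` on `[a, b]`, `f'` is absolutely continuous with a.e. derivative
`f''`, and `f''` is square integrable. -/
structure IsH2 (a b : ℝ) (f f' f'' : ℝ → ℝ) : Prop where
  memLp : MemLp f'' 2 (volume.restrict (Icc a b))
  integral_deriv : ∀ x ∈ Icc a b, f x = f a + ∫ t in a..x, f' t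
  integral_deriv2 : ∀ x ∈ Icc a b, f' x = f' a + ∫ t in a..x, f'' t

namespace QuantumGraph

section

variable {V E : Type*} (G : QuantumGraph V E)

open Classical in
/-- The sum over all edge ends at `v` of the derivatives taken into the edge and away from `v`
(a loop at `v` contributes both of its ends). -/
noncomputable def outgoingSum [Fintype E] (f' : E → ℝ → ℝ) (v : V) : ℝ :=
  ∑ e, ((if G.src e = v then f' e (G.lo e) else 0) +
    (if G.tgt e = v then -f' e (G.hi e) else 0))

/-- `f`, with edgewise first and second derivatives `f'` and `f''`, lies in the domain of the
Hamiltonian: it is `H²` on every edge, continuous at the vertices (`φ` being the vertex values),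
it vanishes at the Dirichlet vertices, and at every other vertex the sum of the outgoing
derivatives is the coupling times the value. -/
def InDomain [Fintype E] (f f' f'' : E → ℝ → ℝ) : Prop :=
  (∀ e, IsH2 (G.lo e) (G.hi e) (f e) (f' e) (f'' e)) ∧
  ∃ φ : V → ℝ,
    (∀ e, f e (G.lo e) = φ (G.src e) ∧ f e (G.hi e) = φ (G.tgt e)) ∧
    (∀ v, G.coupling v = ⊤ → φ v = 0) ∧
    (∀ v (α : ℝ), G.coupling v = (α : WithTop ℝ) → G.outgoingSum f' v = α * φ v)

/-- `μ` is an eigenvalue of the Hamiltonian: some function of the domain that is not zero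
satisfies `-f'' + pot f = μ f`. -/
def IsEigenvalue [Fintype E] (μ : ℝ) : Prop :=
  ∃ f f' f'' : E → ℝ → ℝ, G.InDomain f f' f'' ∧
    (∃ e, ∃ x ∈ Icc (G.lo e) (G.hi e), f e x ≠ 0) ∧
    ∀ e, ∀ᵐ x ∂(volume.restrict (Icc (G.lo e) (G.hi e))),
      -f'' e x + G.pot e x * f e x = μ * f e x

/-- The set of eigenvalues of the Hamiltonian. -/
def eigenvalues [Fintype E] : Set ℝ := {μ | G.IsEigenvalue μ}

/-- The groundstate energy `λ₁`, the lowest eigenvalue. -/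
noncomputable def groundEnergy [Fintype E] : ℝ := sInf G.eigenvalues

/-- Two edges are linked if they share a vertex that does not carry the Dirichlet condition.
(The Dirichlet condition at a vertex is equivalent to cutting the graph there.) -/
def Linked (e e' : E) : Prop :=
  ∃ v, G.coupling v ≠ ⊤ ∧ (G.src e = v ∨ G.tgt e = v) ∧ (G.src e' = v ∨ G.tgt e' = v)

/-- Two edges are equivalent if a finite chain of linked edges joins them. -/
def linkSetoid : Setoid E := Relation.EqvGen.setoid G.Linked

/-- The connected components of the graph cut at its Dirichlet vertices, as classes of edges. -/
abbrev Component : Type _ := Quotient G.linkSetoid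

/-- The graph is connected: any two edges are joined by a chain of linked edges. Isolated
vertices carry no functions and are disregarded. If the Dirichlet vertices have degree one, this
is connectedness of the graph in the usual sense. -/
def Connected : Prop := ∀ e e' : E, G.linkSetoid e e'

/-- The subgraph formed by the edges of one component, with the vertex conditions of `G`.
(Vertices that are ends of no edge of the component become isolated and play no role.) -/
def subgraph (c : G.Component) :
    QuantumGraph V {e : E // (Quotient.mk G.linkSetoid e) = c} where
  src e := G.src e
  tgt e := G.tgt e
  lo e := G.lo e
  hi e := G.hi e
  lo_lt_hi e := G.lo_lt_hi e
  pot e := G.pot e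
  pot_bounded e := G.pot_bounded e
  pot_piecewise e := G.pot_piecewise e
  coupling := G.coupling

end

/-- A proper `m`-partition of `G`: a set of `m` distinct points in the interiors of edges.
The `n e` points on the edge `e` are recorded in increasing order, together with the ends of `e`:
`lo e = t 0 < t 1 < ⋯ < t (n e) < t (n e + 1) = hi e`. -/
structure Partition {V E : Type*} [Fintype E] (G : QuantumGraph V E) (m : ℕ) where
  /-- the number of partition points on an edge -/
  n : E → ℕ
  /-- the partition points on an edge and its two ends, in increasing order -/
  t : (e : E) → Fin (n e + 2) → ℝ
  strictMono : ∀ e, StrictMono (t e)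
  t_zero : ∀ e, t e 0 = G.lo e
  t_last : ∀ e, t e (Fin.last (n e + 1)) = G.hi e
  sum_n : ∑ e, n e = m

namespace Partition

section

variable {V E : Type*} [Fintype E] {G : QuantumGraph V E} {m : ℕ} (P : G.Partition m)

/-- The index set of the partition vertices. -/
abbrev Vertex : Type _ := Σ e : E, Fin (P.n e)

/-- The coordinate of a partition vertex on its edge. -/
def pos (p : P.Vertex) : ℝ := P.t p.1 p.2.succ.castSucc

/-- The segments into which the edges are divided. -/
abbrev Segment : Type _ := Σ e : E, Fin (P.n e + 1)

theorem Icc_subset (s : P.Segment) :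
    Icc (P.t s.1 s.2.castSucc) (P.t s.1 s.2.succ) ⊆ Icc (G.lo s.1) (G.hi s.1) := by
  rw [← P.t_zero, ← P.t_last]
  exact Icc_subset_Icc ((P.strictMono s.1).monotone (Fin.zero_le _))
    ((P.strictMono s.1).monotone (Fin.le_last _))

/-- The graph `G` with the partition vertices introduced on its edges, and the Dirichlet
condition imposed at each of them. -/
def divided : QuantumGraph (V ⊕ P.Vertex) P.Segment where
  src s := Fin.cases (motive := fun _ => V ⊕ P.Vertex)
    (Sum.inl (G.src s.1)) (fun k => Sum.inr ⟨s.1, k⟩) s.2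
  tgt s := Fin.lastCases (motive := fun _ => V ⊕ P.Vertex)
    (Sum.inl (G.tgt s.1)) (fun k => Sum.inr ⟨s.1, k⟩) s.2
  lo s := P.t s.1 s.2.castSucc
  hi s := P.t s.1 s.2.succ
  lo_lt_hi s := P.strictMono s.1 s.2.castSucc_lt_succ
  pot s := G.pot s.1
  pot_bounded s := by
    obtain ⟨M, hM⟩ := G.pot_bounded s.1
    exact ⟨M, fun x hx => hM x (P.Icc_subset s hx)⟩
  pot_piecewise s := by
    obtain ⟨S, hS⟩ := G.pot_piecewise s.1
    exact ⟨S, hS.mono (sdiff_subset_sdiff_left (P.Icc_subset s))⟩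
  coupling := Sum.elim G.coupling (fun _ => ⊤)

/-- The index set of the subgraphs `Γ_j` of the partition. -/
abbrev Part : Type _ := P.divided.Component

open Classical in
/-- The eigenvalues of the subgraph `Γ_j`. -/
noncomputable def partEigenvalues (j : P.Part) : Set ℝ := (P.divided.subgraph j).eigenvalues

open Classical in
/-- The groundstate energy `λ₁(Γ_j)`. -/
noncomputable def partEnergy (j : P.Part) : ℝ := (P.divided.subgraph j).groundEnergy

/-- The energy functional `Λ(P) = max_j λ₁(Γ_j)`; there are finitely many subgraphs. -/
noncomputable def energy : ℝ := ⨆ j : P.Part, P.partEnergy j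

/-- `P` is an equipartition: all its subgraphs have the same lowest eigenvalue. -/
def IsEquipartition : Prop := ∃ μ : ℝ, ∀ j : P.Part, IsLeast (P.partEigenvalues j) μ

/-- `Q` lies in the `ε`-neighborhood of `P`: it is obtained by moving every partition vertex of
`P` along its edge by a distance smaller than `ε`. -/
def IsNear (ε : ℝ) (Q : G.Partition m) : Prop :=
  ∃ σ : P.Vertex ≃ Q.Vertex, ∀ p, (σ p).1 = p.1 ∧ |Q.pos (σ p) - P.pos p| < ε

/-- `P` is a local minimum of `Λ` on the set of proper `m`-partitions. -/
def IsLocalMinEnergy : Prop :=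
  ∃ ε : ℝ, 0 < ε ∧ ∀ Q : G.Partition m, P.IsNear ε Q → P.energy ≤ Q.energy

end

end Partition

end QuantumGraph

/-!
The lowest eigenvalue of `H` on a compact graph is the minimum of the Rayleigh quotient of the
form of `H`: the minimum is attained because `H¹` embeds compactly into the continuous functions,
and a minimizer is an eigenfunction by the lemma of du Bois-Reymond.

Extending functions by zero shows that lengthening an edge of a graph at a Dirichlet end does not
raise the lowest eigenvalue. If the graph is connected it lowers it strictly: a minimizer on the
larger graph that vanishes on an interval vanishes on all of it, by uniqueness for the ordinary
differential equation and, at each vertex, by the vertex condition for its absolute value, which is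
also a minimizer. Conversely, cutting a minimizer off at a small height with the soft threshold
function shows that shortening an edge a little at a Dirichlet end raises the lowest eigenvalue
only a little.

If some part of `P` has an energy below `Λ(P)`, then by connectedness some point of `P` separates a
part of maximal energy from one whose energy is not maximal. Moving this point slightly into the
latter lowers the former energy and keeps the other below `Λ(P)`. Either `Λ` decreases, which local
minimality excludes, or the number of maximal parts does, and induction on this number applies to
the new partition, which is again a local minimum.
-/

/-! ### Sobolev functions on an interval -/

theorem intervalIntegrable_of_memLp_two {a b : ℝ} {f : ℝ → ℝ} (hab : a ≤ b)
    (hf : MemLp f 2 (volume.restrict (Icc a b))) : IntervalIntegrable f volume a b := by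
  rw [intervalIntegrable_iff_integrableOn_Icc_of_le hab]
  exact hf.integrable one_le_two

theorem intervalIntegrable_mul_of_memLp_two {a b : ℝ} {f g : ℝ → ℝ} (hab : a ≤ b)
    (hf : MemLp f 2 (volume.restrict (Icc a b))) (hg : MemLp g 2 (volume.restrict (Icc a b))) :
    IntervalIntegrable (fun x => f x * g x) volume a b := by
  rw [intervalIntegrable_iff_integrableOn_Icc_of_le hab]
  exact hf.integrable_mul hg

theorem memLp_two_of_continuousOn_Icc {a b : ℝ} {f : ℝ → ℝ} (hf : ContinuousOn f (Icc a b)) :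
    MemLp f 2 (volume.restrict (Icc a b)) := by
  obtain ⟨C, hC⟩ := isCompact_Icc.exists_bound_of_continuousOn hf
  exact MemLp.of_bound (hf.aestronglyMeasurable measurableSet_Icc) C
    ((ae_restrict_iff' measurableSet_Icc).2 (.of_forall hC))

theorem ae_eq_zero_of_integral_mul_self_eq_zero {a b : ℝ} {f : ℝ → ℝ} (hab : a ≤ b)
    (hf : MemLp f 2 (volume.restrict (Icc a b))) (h : ∫ x in a..b, f x * f x = 0) :
    f =ᵐ[volume.restrict (Icc a b)] 0 := by
  rw [intervalIntegral.integral_of_le hab, ← integral_Icc_eq_integral_Ioc,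
    integral_eq_zero_iff_of_nonneg (fun x => mul_self_nonneg _) (hf.integrable_mul hf)] at h
  filter_upwards [h] with x hx
  exact mul_self_eq_zero.1 hx

theorem absolutelyContinuousOnInterval_of_dist_le {f g : ℝ → ℝ} {a b K : ℝ}
    (hf : AbsolutelyContinuousOnInterval f a b)
    (h : ∀ x ∈ uIcc a b, ∀ y ∈ uIcc a b, dist (g x) (g y) ≤ K * dist (f x) (f y)) :
    AbsolutelyContinuousOnInterval g a b := by
  have hlim := Filter.Tendsto.const_mul K hf
  rw [mul_zero] at hlim
  refine squeeze_zero' (.of_forall fun E => Finset.sum_nonneg fun _ _ => dist_nonneg) ?_ hlim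
  filter_upwards [Filter.mem_inf_of_right (Filter.mem_principal_self _)] with E hE
  rw [Finset.mul_sum]
  exact Finset.sum_le_sum fun i hi => h _ (hE.1 i hi).1 _ (hE.1 i hi).2

theorem abs_deriv_comp_le_of_lipschitzWith {φ f : ℝ → ℝ} {f' x : ℝ} (hφ : LipschitzWith 1 φ)
    (hf : HasDerivAt f f' x) : |deriv (fun y => φ (f y)) x| ≤ |f'| := by
  refine le_of_forall_pos_le_add fun ε hε => ?_
  refine norm_deriv_le_of_lip' (𝕜 := ℝ) (F := ℝ) (by positivity) ?_
  filter_upwards [(hasDerivAt_iff_isLittleO.1 hf).bound hε] with y hy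
  have hlip : ‖φ (f y) - φ (f x)‖ ≤ ‖f y - f x‖ := by
    simpa only [dist_eq_norm, NNReal.coe_one, one_mul] using hφ.dist_le_mul (f y) (f x)
  calc _ ≤ ‖f y - f x‖ := hlip
    _ = ‖(f y - f x - (y - x) • f') + (y - x) • f'‖ := by rw [sub_add_cancel]
    _ ≤ ε * ‖y - x‖ + ‖y - x‖ * ‖f'‖ := (norm_add_le _ _).trans (by rw [norm_smul]; gcongr)
    _ = (|f'| + ε) * ‖y - x‖ := by rw [Real.norm_eq_abs f']; ring

theorem integral_indicator_Icc {a b c x : ℝ} (hc : c ≤ a) (hx : c ≤ x) (f : ℝ → ℝ) :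
    ∫ t in c..x, (Icc a b).indicator f t = ∫ t in a..max a (min x b), f t := by
  rw [intervalIntegral.integral_of_le hx, intervalIntegral.integral_of_le (le_max_left _ _),
    setIntegral_indicator measurableSet_Icc]
  refine setIntegral_congr_set ?_
  have h : (Ioc c x ∩ Icc a b : Set ℝ) =ᵐ[volume] (Ioc c x ∩ Ioc a b : Set ℝ) :=
    Filter.EventuallyEq.rfl.inter Ioc_ae_eq_Icc.symm
  have hset : Ioc c x ∩ Ioc a b = Ioc a (max a (min x b)) := by
    ext t
    simp only [mem_inter_iff, mem_Ioc, le_max_iff, le_min_iff]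
    grind
  rwa [hset] at h

/-- `f` is absolutely continuous on `[a, b]` with almost everywhere derivative `f'`. -/
structure IsAC (a b : ℝ) (f f' : ℝ → ℝ) : Prop where
  integrable : IntervalIntegrable f' volume a b
  integral_deriv : ∀ x ∈ Icc a b, f x = f a + ∫ t in a..x, f' t

/-- `f` belongs to the Sobolev space `H¹(a, b)` with weak derivative `f'`. -/
structure IsH1 (a b : ℝ) (f f' : ℝ → ℝ) : Prop where
  memLp : MemLp f' 2 (volume.restrict (Icc a b))
  integral_deriv : ∀ x ∈ Icc a b, f x = f a + ∫ t in a..x, f' t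

namespace IsAC

variable {a b : ℝ} {f f' g g' : ℝ → ℝ}

theorem intervalIntegrable (hf : IsAC a b f f') {x y : ℝ} (hx : x ∈ Icc a b) (hy : y ∈ Icc a b) :
    IntervalIntegrable f' volume x y := by
  refine hf.integrable.mono_set ?_
  rw [uIcc_of_le (hx.1.trans hx.2)]
  exact uIcc_subset_Icc hx hy

theorem sub_eq (hf : IsAC a b f f') {x y : ℝ} (hx : x ∈ Icc a b) (hy : y ∈ Icc a b) :
    f y - f x = ∫ t in x..y, f' t := by
  have ha : a ∈ Icc a b := left_mem_Icc.2 (hx.1.trans hx.2)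
  rw [hf.integral_deriv x hx, hf.integral_deriv y hy,
    ← intervalIntegral.integral_add_adjacent_intervals (hf.intervalIntegrable ha hx)
      (hf.intervalIntegrable hx hy)]
  ring

theorem mono (hf : IsAC a b f f') {c d : ℝ} (hc : a ≤ c) (hcd : c ≤ d) (hd : d ≤ b) :
    IsAC c d f f' := by
  have hc' : c ∈ Icc a b := ⟨hc, hcd.trans hd⟩
  refine ⟨hf.intervalIntegrable hc' ⟨hc.trans hcd, hd⟩, fun x hx => ?_⟩
  rw [← hf.sub_eq hc' ⟨hc.trans hx.1, hx.2.trans hd⟩]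
  ring

theorem primitive (hf : IntervalIntegrable f' volume a b) (c : ℝ) :
    IsAC a b (fun x => c + ∫ t in a..x, f' t) f' :=
  ⟨hf, fun x _ => by simp⟩

theorem absolutelyContinuous (hf : IsAC a b f f') (hab : a ≤ b) :
    AbsolutelyContinuousOnInterval f a b := by
  refine absolutelyContinuousOnInterval_of_dist_le (K := 1)
    (hf.integrable.absolutelyContinuousOnInterval_intervalIntegral (c := a) left_mem_uIcc) ?_
  rw [uIcc_of_le hab]
  intro x hx y hy
  rw [hf.integral_deriv x hx, hf.integral_deriv y hy, dist_add_left, one_mul]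

theorem ae_hasDerivAt (hf : IsAC a b f f') (hab : a ≤ b) :
    ∀ᵐ x ∂(volume.restrict (Icc a b)), HasDerivAt f (f' x) x := by
  rw [← restrict_Ioo_eq_restrict_Icc, ae_restrict_iff' measurableSet_Ioo]
  filter_upwards [hf.integrable.ae_hasDerivAt_integral] with x hx hxab
  have hd := (hx (uIcc_of_le hab ▸ Ioo_subset_Icc_self hxab) a left_mem_uIcc).const_add (f a)
  refine hd.congr_of_eventuallyEq ?_
  filter_upwards [Ioo_mem_nhds hxab.1 hxab.2] with y hy
  exact hf.integral_deriv y (Ioo_subset_Icc_self hy)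

theorem of_ae_hasDerivAt (hab : a ≤ b) (hf : AbsolutelyContinuousOnInterval f a b)
    (hd : ∀ᵐ x ∂(volume.restrict (Icc a b)), HasDerivAt f (f' x) x) : IsAC a b f f' := by
  rw [ae_restrict_iff' measurableSet_Icc] at hd
  refine ⟨hf.intervalIntegrable_deriv.congr_ae ?_, fun x hx => ?_⟩
  · rw [uIoc_of_le hab, Filter.EventuallyEq, ae_restrict_iff' measurableSet_Ioc]
    exact hd.mono fun x hx hxab => (hx (Ioc_subset_Icc_self hxab)).deriv
  · have hcongr : ∫ t in a..x, f' t = ∫ t in a..x, deriv f t := by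
      refine intervalIntegral.integral_congr_ae (hd.mono fun t ht htx => ?_)
      rw [uIoc_of_le hx.1] at htx
      exact (ht ⟨htx.1.le, htx.2.trans hx.2⟩).deriv.symm
    have hsub : uIcc a x ⊆ uIcc a b := by
      rw [uIcc_of_le hx.1, uIcc_of_le hab]
      exact Icc_subset_Icc_right hx.2
    rw [hcongr, (hf.mono hsub).integral_deriv_eq_sub, add_sub_cancel]

theorem continuousOn (hf : IsAC a b f f') : ContinuousOn f (Icc a b) := by
  by_cases hab : a ≤ b
  · simpa only [uIcc_of_le hab] using (hf.absolutelyContinuous hab).continuousOn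
  · simp only [Icc_eq_empty hab, continuousOn_empty]

theorem of_hasDerivAt (h : ∀ x, HasDerivAt f (f' x) x) (hc : Continuous f') : IsAC a b f f' := by
  refine ⟨hc.intervalIntegrable _ _, fun x _ => ?_⟩
  rw [intervalIntegral.integral_eq_sub_of_hasDerivAt (fun y _ => h y) (hc.intervalIntegrable _ _)]
  ring

theorem add (hf : IsAC a b f f') (hg : IsAC a b g g') :
    IsAC a b (fun x => f x + g x) (fun x => f' x + g' x) := by
  refine ⟨hf.integrable.add hg.integrable, fun x hx => ?_⟩
  have ha : a ∈ Icc a b := left_mem_Icc.2 (hx.1.trans hx.2)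
  rw [intervalIntegral.integral_add (hf.intervalIntegrable ha hx) (hg.intervalIntegrable ha hx),
    hf.integral_deriv x hx, hg.integral_deriv x hx]
  ring

theorem mul (hf : IsAC a b f f') (hg : IsAC a b g g') (hab : a ≤ b) :
    IsAC a b (fun x => f x * g x) (fun x => f' x * g x + f x * g' x) := by
  refine of_ae_hasDerivAt hab
    ((hf.absolutelyContinuous hab).mul (hg.absolutelyContinuous hab)) ?_
  filter_upwards [hf.ae_hasDerivAt hab, hg.ae_hasDerivAt hab] with x hx hx'
  exact hx.mul hx'

theorem integral_mul (hf : IsAC a b f f') (hg : IsAC a b g g') (hab : a ≤ b) :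
    ∫ x in a..b, (f' x * g x + f x * g' x) = f b * g b - f a * g a :=
  ((hf.mul hg hab).sub_eq (left_mem_Icc.2 hab) (right_mem_Icc.2 hab)).symm

theorem monotoneOn (hf : IsAC a b f f') (h : ∀ᵐ x ∂(volume.restrict (Icc a b)), 0 ≤ f' x) :
    MonotoneOn f (Icc a b) := by
  intro x hx y hy hxy
  rw [← sub_nonneg, hf.sub_eq hx hy]
  exact intervalIntegral.integral_nonneg_of_ae_restrict hxy
    (ae_restrict_of_ae_restrict_of_subset (Icc_subset_Icc hx.1 hy.2) h)

theorem antitoneOn (hf : IsAC a b f f') (h : ∀ᵐ x ∂(volume.restrict (Icc a b)), f' x ≤ 0) :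
    AntitoneOn f (Icc a b) := by
  intro x hx y hy hxy
  rw [← sub_nonpos, hf.sub_eq hx hy]
  have := intervalIntegral.integral_nonneg_of_ae_restrict (f := fun t => -f' t) hxy
    (ae_restrict_of_ae_restrict_of_subset (Icc_subset_Icc hx.1 hy.2)
      (h.mono fun t ht => neg_nonneg.2 ht))
  rwa [intervalIntegral.integral_neg, neg_nonneg] at this

theorem mul_exp (hf : IsAC a b f f') (hab : a ≤ b) (c : ℝ) :
    IsAC a b (fun x => f x * Real.exp (c * x)) (fun x => (f' x + c * f x) * Real.exp (c * x)) := by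
  have hexp : IsAC a b (fun x => Real.exp (c * x)) (fun x => Real.exp (c * x) * c) :=
    of_hasDerivAt (fun x => by simpa using ((hasDerivAt_id x).const_mul c).exp) (by fun_prop)
  convert hf.mul hexp hab using 2
  ring

/-- Grönwall's argument: `f · exp(-C x)` is antitone and `f · exp(C x)` is monotone. -/
theorem nonpos_of_abs_deriv_le (hf : IsAC a b f f') {C : ℝ}
    (hC : ∀ᵐ x ∂(volume.restrict (Icc a b)), |f' x| ≤ C * f x) {x₀ : ℝ} (hx₀ : x₀ ∈ Icc a b)
    (h0 : f x₀ = 0) : ∀ x ∈ Icc a b, f x ≤ 0 := by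
  have hab := hx₀.1.trans hx₀.2
  have hanti := (hf.mul_exp hab (-C)).antitoneOn <| hC.mono fun x hx =>
    mul_nonpos_of_nonpos_of_nonneg (by linarith [le_abs_self (f' x)]) (Real.exp_pos _).le
  have hmono := (hf.mul_exp hab C).monotoneOn <| hC.mono fun x hx =>
    mul_nonneg (by linarith [neg_abs_le (f' x)]) (Real.exp_pos _).le
  intro x hx
  rcases le_total x₀ x with hle | hle
  · have := hanti hx₀ hx hle
    simp only [h0, zero_mul] at this
    exact nonpos_of_mul_nonpos_left this (Real.exp_pos _)
  · have := hmono hx hx₀ hle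
    simp only [h0, zero_mul] at this
    exact nonpos_of_mul_nonpos_left this (Real.exp_pos _)

theorem eq_zero_of_eq_zero_at {u u' u'' : ℝ → ℝ} (hu : IsAC a b u u') (hu' : IsAC a b u' u'')
    {K : ℝ} (hK : ∀ᵐ x ∂(volume.restrict (Icc a b)), |u'' x| ≤ K * |u x|)
    {x₀ : ℝ} (hx₀ : x₀ ∈ Icc a b) (h0 : u x₀ = 0) (h0' : u' x₀ = 0) :
    ∀ x ∈ Icc a b, u x = 0 ∧ u' x = 0 := by
  have hab := hx₀.1.trans hx₀.2
  have henergy := (hu.mul hu hab).add (hu'.mul hu' hab)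
  have hgrowth : ∀ᵐ x ∂(volume.restrict (Icc a b)),
      |(u' x * u x + u x * u' x) + (u'' x * u' x + u' x * u'' x)| ≤
        (1 + |K|) * (u x * u x + u' x * u' x) := by
    filter_upwards [hK] with x hx
    have h1 : |u'' x| ≤ |K| * |u x| := hx.trans (by gcongr; exact le_abs_self K)
    calc _ = |2 * (u x * u' x) + 2 * (u'' x * u' x)| := by ring_nf
      _ ≤ |2 * (u x * u' x)| + |2 * (u'' x * u' x)| := abs_add_le _ _
      _ = 2 * (|u x| * |u' x|) + 2 * (|u'' x| * |u' x|) := by simp only [abs_mul, abs_two]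
      _ ≤ 2 * (|u x| * |u' x|) + 2 * ((|K| * |u x|) * |u' x|) := by gcongr
      _ = (1 + |K|) * (2 * |u x| * |u' x|) := by ring
      _ ≤ (1 + |K|) * (|u x| ^ 2 + |u' x| ^ 2) := by gcongr; exact two_mul_le_add_sq _ _
      _ = _ := by simp only [sq_abs]; ring
  intro x hx
  have := henergy.nonpos_of_abs_deriv_le hgrowth hx₀
    (by simp only [h0, h0', mul_zero, add_zero]) x hx
  constructor <;> nlinarith [mul_self_nonneg (u x), mul_self_nonneg (u' x)]

theorem hasDerivWithinAt (hf : IsAC a b f f') (hf' : ContinuousOn f' (Icc a b)) {x : ℝ}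
    (hx : x ∈ Icc a b) : HasDerivWithinAt f (f' x) (Icc a b) x := by
  have ha : a ∈ Icc a b := left_mem_Icc.2 (hx.1.trans hx.2)
  have : Fact (x ∈ Icc a b) := ⟨hx⟩
  have hmeas : StronglyMeasurableAtFilter f' (nhdsWithin x (Icc a b)) :=
    hf'.stronglyMeasurableAtFilter_nhdsWithin measurableSet_Icc x
  have hd := intervalIntegral.integral_hasDerivWithinAt_right (s := Icc a b)
    (hf.intervalIntegrable ha hx) hmeas (hf' x hx)
  exact (hd.const_add (f a)).congr hf.integral_deriv (hf.integral_deriv x hx)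

theorem deriv_mul_sub_nonneg_of_isMinOn (hf : IsAC a b f f') (hf' : ContinuousOn f' (Icc a b))
    {x y : ℝ} (hx : x ∈ Icc a b) (hy : y ∈ Icc a b) (hmin : IsMinOn f (Icc a b) x) :
    0 ≤ f' x * (y - x) := by
  have h := hmin.localize.hasFDerivWithinAt_nonneg (hf.hasDerivWithinAt hf' hx).hasFDerivWithinAt
    (sub_mem_posTangentConeAt_of_segment_subset ((convex_Icc a b).segment_subset hx hy))
  simpa [mul_comm] using h

theorem abs_sub_le (hf : IsAC a b f f') {x y : ℝ} (hx : x ∈ Icc a b) (hy : y ∈ Icc a b) :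
    |f y - f x| ≤ ∫ t in a..b, |f' t| := by
  have hab := hx.1.trans hx.2
  rw [hf.sub_eq hx hy, intervalIntegral.integral_of_le hab]
  refine (intervalIntegral.norm_integral_le_integral_norm_uIoc (f := f')).trans ?_
  refine setIntegral_mono_set ((intervalIntegrable_iff_integrableOn_Ioc_of_le hab).1
    hf.integrable).norm (.of_forall fun _ => norm_nonneg _) (Filter.Eventually.of_forall ?_)
  exact Ioc_subset_Ioc (le_min hx.1 hy.1) (max_le hx.2 hy.2)

theorem lipschitz_comp (hf : IsAC a b f f') (hab : a ≤ b) {φ : ℝ → ℝ} (hφ : LipschitzWith 1 φ) :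
    IsAC a b (fun x => φ (f x)) (deriv fun x => φ (f x)) := by
  have hac : AbsolutelyContinuousOnInterval (fun x => φ (f x)) a b :=
    absolutelyContinuousOnInterval_of_dist_le (hf.absolutelyContinuous hab) fun x _ y _ =>
      hφ.dist_le_mul (f x) (f y)
  refine of_ae_hasDerivAt hab hac ?_
  rw [ae_restrict_iff' measurableSet_Icc]
  filter_upwards [hac.ae_differentiableAt] with x hx hxab
  exact (hx (uIcc_of_le hab ▸ hxab)).hasDerivAt

end IsAC

namespace IsH1

variable {a b : ℝ} {f f' g g' : ℝ → ℝ}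

theorem isAC (hf : IsH1 a b f f') (hab : a ≤ b) : IsAC a b f f' :=
  ⟨intervalIntegrable_of_memLp_two hab hf.memLp, hf.integral_deriv⟩

theorem continuousOn (hf : IsH1 a b f f') : ContinuousOn f (Icc a b) := by
  by_cases hab : a ≤ b
  · exact (hf.isAC hab).continuousOn
  · simp only [Icc_eq_empty hab, continuousOn_empty]

theorem add (hf : IsH1 a b f f') (hg : IsH1 a b g g') :
    IsH1 a b (fun x => f x + g x) (fun x => f' x + g' x) :=
  ⟨hf.memLp.add hg.memLp, fun x hx =>
    ((hf.isAC (hx.1.trans hx.2)).add (hg.isAC (hx.1.trans hx.2))).integral_deriv x hx⟩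

theorem const_mul (hf : IsH1 a b f f') (c : ℝ) :
    IsH1 a b (fun x => c * f x) (fun x => c * f' x) :=
  ⟨hf.memLp.const_mul c, fun x hx => by
    rw [intervalIntegral.integral_const_mul, hf.integral_deriv x hx]
    ring⟩

theorem of_hasDerivAt (h : ∀ x, HasDerivAt f (f' x) x) (hc : Continuous f') : IsH1 a b f f' :=
  ⟨memLp_two_of_continuousOn_Icc hc.continuousOn, (IsAC.of_hasDerivAt h hc).integral_deriv⟩

theorem congr_deriv (hf : IsH1 a b f f') (h : f' =ᵐ[volume.restrict (Icc a b)] g') :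
    IsH1 a b f g' := by
  refine ⟨hf.memLp.ae_eq h, fun x hx => ?_⟩
  rw [hf.integral_deriv x hx, intervalIntegral.integral_of_le hx.1,
    intervalIntegral.integral_of_le hx.1]
  refine congrArg _ (integral_congr_ae (ae_mono (Measure.restrict_mono ?_ le_rfl) h))
  exact Ioc_subset_Icc_self.trans (Icc_subset_Icc_right hx.2)

theorem linear (p q c : ℝ) : IsH1 a b (fun x => p + q * (x - c)) (fun _ => q) :=
  of_hasDerivAt (fun x => by
    simpa using (((hasDerivAt_id x).sub_const c).const_mul q).const_add p) continuous_const

theorem mono (hf : IsH1 a b f f') {c d : ℝ} (hc : a ≤ c) (hd : d ≤ b) : IsH1 c d f f' := by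
  refine ⟨hf.memLp.mono_measure (Measure.restrict_mono (Icc_subset_Icc hc hd) le_rfl), ?_⟩
  intro x hx
  have hcd := hx.1.trans hx.2
  exact ((hf.isAC (hc.trans (hcd.trans hd))).mono hc hcd hd).integral_deriv x hx

theorem ae_abs_deriv_lipschitz_comp_le (hf : IsH1 a b f f') (hab : a ≤ b) {φ : ℝ → ℝ}
    (hφ : LipschitzWith 1 φ) :
    ∀ᵐ x ∂(volume.restrict (Icc a b)), |deriv (fun x => φ (f x)) x| ≤ |f' x| := by
  filter_upwards [(hf.isAC hab).ae_hasDerivAt hab] with x hx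
  exact abs_deriv_comp_le_of_lipschitzWith hφ hx

theorem lipschitz_comp (hf : IsH1 a b f f') (hab : a ≤ b) {φ : ℝ → ℝ} (hφ : LipschitzWith 1 φ) :
    IsH1 a b (fun x => φ (f x)) (deriv fun x => φ (f x)) :=
  ⟨hf.memLp.mono (measurable_deriv _).aestronglyMeasurable
    (hf.ae_abs_deriv_lipschitz_comp_le hab hφ),
    ((hf.isAC hab).lipschitz_comp hab hφ).integral_deriv⟩

theorem indicator (hf : IsH1 a b f f') (hab : a ≤ b) {c d : ℝ} (hc : c ≤ a) (hd : b ≤ d)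
    (ha : c < a → f a = 0) (hb : b < d → f b = 0) :
    IsH1 c d ((Icc a b).indicator f) ((Icc a b).indicator f') := by
  refine ⟨?_, fun x hx => ?_⟩
  · rw [memLp_indicator_iff_restrict measurableSet_Icc, Measure.restrict_restrict measurableSet_Icc,
      inter_eq_left.2 (Icc_subset_Icc hc hd)]
    exact hf.memLp
  have hc0 : (Icc a b).indicator f c = f a := by
    rcases hc.eq_or_lt with rfl | hlt
    · exact indicator_of_mem (left_mem_Icc.2 hab) f
    · rw [indicator_of_notMem fun h => hlt.not_ge h.1, ha hlt]
  have hmem : max a (min x b) ∈ Icc a b := ⟨le_max_left _ _, max_le hab (min_le_right _ _)⟩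
  rw [hc0, integral_indicator_Icc hc hx.1, ← hf.integral_deriv _ hmem]
  rcases lt_or_ge x a with hxa | hxa
  · rw [indicator_of_notMem fun h => hxa.not_ge h.1, max_eq_left ((min_le_left _ _).trans hxa.le),
      ha (hx.1.trans_lt hxa)]
  rcases le_or_gt x b with hxb | hxb
  · rw [min_eq_left hxb, max_eq_right hxa, indicator_of_mem (show x ∈ Icc a b from ⟨hxa, hxb⟩)]
  · rw [min_eq_right hxb.le, max_eq_right hab, indicator_of_notMem fun h => hxb.not_ge h.2,
      hb (hxb.trans_le hx.2)]

-- The test function is the primitive of `u - c`, with `c` the mean of `u`.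
theorem exists_ae_eq_const {u : ℝ → ℝ} (hab : a < b) (hu : MemLp u 2 (volume.restrict (Icc a b)))
    (h : ∀ g g' : ℝ → ℝ, IsH1 a b g g' → g a = 0 → g b = 0 → ∫ x in a..b, u x * g' x = 0) :
    ∃ c : ℝ, u =ᵐ[volume.restrict (Icc a b)] fun _ => c := by
  set c : ℝ := (b - a)⁻¹ * ∫ x in a..b, u x
  have hk : MemLp (fun x => u x - c) 2 (volume.restrict (Icc a b)) := hu.sub (memLp_const c)
  have hui := intervalIntegrable_of_memLp_two hab.le hu
  have hki := intervalIntegrable_of_memLp_two hab.le hk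
  have hk0 : ∫ x in a..b, (u x - c) = 0 := by
    rw [intervalIntegral.integral_sub hui intervalIntegrable_const, intervalIntegral.integral_const,
      smul_eq_mul, mul_inv_cancel_left₀ (sub_ne_zero.2 hab.ne'), sub_self]
  have hortho := h (fun x => ∫ t in a..x, (u t - c)) _ ⟨hk, fun x _ => by
    rw [intervalIntegral.integral_same, zero_add]⟩ intervalIntegral.integral_same hk0
  refine ⟨c, (ae_eq_zero_of_integral_mul_self_eq_zero hab.le hk ?_).mono fun x hx =>
    sub_eq_zero.1 hx⟩
  calc ∫ x in a..b, (u x - c) * (u x - c)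
      = ∫ x in a..b, (u x * (u x - c) - c * (u x - c)) := by simp only [sub_mul]
    _ = 0 := by
      rw [intervalIntegral.integral_sub (intervalIntegrable_mul_of_memLp_two hab.le hu hk)
        (hki.const_mul c), hortho, intervalIntegral.integral_const_mul, hk0, mul_zero, sub_zero]

/-- The lemma of du Bois-Reymond. -/
theorem exists_ae_eq_primitive (hf : IsH1 a b f f') (hab : a < b) {w : ℝ → ℝ}
    (hw : IntervalIntegrable w volume a b)
    (h : ∀ g g' : ℝ → ℝ, IsH1 a b g g' → g a = 0 → g b = 0 →
      ∫ x in a..b, (f' x * g' x + w x * g x) = 0) :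
    ∃ c : ℝ, f' =ᵐ[volume.restrict (Icc a b)] fun x => c + ∫ t in a..x, w t := by
  set W : ℝ → ℝ := fun x => 0 + ∫ t in a..x, w t with hW
  have hWac : IsAC a b W w := IsAC.primitive hw 0
  have hWm : MemLp W 2 (volume.restrict (Icc a b)) :=
    memLp_two_of_continuousOn_Icc hWac.continuousOn
  obtain ⟨c, hc⟩ := exists_ae_eq_const hab (hf.memLp.sub hWm) fun g g' hg hga hgb => by
    have hparts := hWac.integral_mul (hg.isAC hab.le) hab.le
    rw [hga, hgb, mul_zero, mul_zero, sub_zero] at hparts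
    have hfg := intervalIntegrable_mul_of_memLp_two hab.le hf.memLp hg.memLp
    have hWg := intervalIntegrable_mul_of_memLp_two hab.le hWm hg.memLp
    have hwg : IntervalIntegrable (fun x => w x * g x) volume a b :=
      hw.mul_continuousOn (by rw [uIcc_of_le hab.le]; exact hg.continuousOn)
    calc ∫ x in a..b, (f' - W) x * g' x
        = ∫ x in a..b, ((f' x * g' x + w x * g x) - (w x * g x + W x * g' x)) :=
          intervalIntegral.integral_congr fun x _ => by simp only [Pi.sub_apply]; ring
      _ = 0 := by
        rw [intervalIntegral.integral_sub (hfg.add hwg) (hwg.add hWg), h g g' hg hga hgb, hparts,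
          sub_zero]
  refine ⟨c, hc.mono fun x hx => ?_⟩
  simp only [hW, Pi.sub_apply] at hx
  linarith

theorem exists_mul_sq_le_integral (hf : IsH1 a b f f') (hab : a ≤ b) :
    ∃ y ∈ Icc a b, (b - a) * (f y * f y) ≤ ∫ t in a..b, f t * f t := by
  have hsq : ContinuousOn (fun t => f t * f t) (Icc a b) := hf.continuousOn.mul hf.continuousOn
  obtain ⟨y, hy, hmin⟩ := isCompact_Icc.exists_isMinOn (nonempty_Icc.2 hab) hsq
  refine ⟨y, hy, ?_⟩
  rw [← smul_eq_mul, ← intervalIntegral.integral_const]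
  exact intervalIntegral.integral_mono_on hab intervalIntegrable_const
    (hsq.intervalIntegrable_of_Icc hab) hmin

-- Starting from a point where `f²` is at most its mean, `f²` is the primitive of `2 f f'`.
theorem exists_sq_le (hab : a < b) {ε : ℝ} (hε : 0 < ε) :
    ∃ K, ∀ f f' : ℝ → ℝ, IsH1 a b f f' → ∀ x ∈ Icc a b,
      f x * f x ≤ ε * (∫ t in a..b, f' t * f' t) + K * ∫ t in a..b, f t * f t := by
  refine ⟨ε⁻¹ + (b - a)⁻¹, fun f f' hf x hx => ?_⟩
  obtain ⟨y, hy, hmean⟩ := hf.exists_mul_sq_le_integral hab.le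
  have hfm := memLp_two_of_continuousOn_Icc hf.continuousOn
  have hff := intervalIntegrable_mul_of_memLp_two hab.le hfm hfm
  have hf'f' := intervalIntegrable_mul_of_memLp_two hab.le hf.memLp hf.memLp
  have hsq := (hf.isAC hab.le).mul (hf.isAC hab.le) hab.le
  have hyoung : ∀ t, |f' t * f t + f t * f' t| ≤ ε * (f' t * f' t) + ε⁻¹ * (f t * f t) := by
    intro t
    have hsum : ε * (f' t * f' t) + ε⁻¹ * (f t * f t) =
        ε⁻¹ * (ε * f' t + f t) ^ 2 - 2 * (f' t * f t) := by field_simp; ring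
    have hdiff : ε * (f' t * f' t) + ε⁻¹ * (f t * f t) =
        ε⁻¹ * (ε * f' t - f t) ^ 2 + 2 * (f' t * f t) := by field_simp; ring
    have h1 : 0 ≤ ε⁻¹ * (ε * f' t + f t) ^ 2 := by positivity
    have h2 : 0 ≤ ε⁻¹ * (ε * f' t - f t) ^ 2 := by positivity
    rw [abs_le]
    constructor <;> linarith
  have hosc : |f x * f x - f y * f y| ≤
      ε * (∫ t in a..b, f' t * f' t) + ε⁻¹ * ∫ t in a..b, f t * f t := by
    refine (hsq.abs_sub_le hy hx).trans ?_
    rw [← intervalIntegral.integral_const_mul, ← intervalIntegral.integral_const_mul,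
      ← intervalIntegral.integral_add (hf'f'.const_mul ε) (hff.const_mul ε⁻¹)]
    exact intervalIntegral.integral_mono_on hab.le hsq.integrable.norm
      ((hf'f'.const_mul ε).add (hff.const_mul ε⁻¹)) fun t _ => hyoung t
  have hy' : f y * f y ≤ (b - a)⁻¹ * ∫ t in a..b, f t * f t := by
    rwa [inv_mul_eq_div, le_div_iff₀' (sub_pos.2 hab)]
  linarith [le_abs_self (f x * f x - f y * f y)]

end IsH1

namespace IsH2

variable {a b : ℝ} {f f' f'' : ℝ → ℝ}

theorem isH1_deriv (h : IsH2 a b f f' f'') : IsH1 a b f' f'' := ⟨h.memLp, h.integral_deriv2⟩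

theorem isH1 (h : IsH2 a b f f' f'') : IsH1 a b f f' :=
  ⟨memLp_two_of_continuousOn_Icc h.isH1_deriv.continuousOn, h.integral_deriv⟩

end IsH2

/-! ### Minimizers of Rayleigh quotients -/

section Rayleigh

open Filter Topology

variable {X : Type*}

theorem exists_rayleigh_minimizing_seq [AddCommGroup X] [Module ℝ X] [Nontrivial X]
    {h ν : LinearMap.BilinForm ℝ X} (ν_pos : ∀ x ≠ 0, 0 < ν x x) {K : ℝ}
    (hK : ∀ x, 0 ≤ h x x + K * ν x x) :
    ∃ μ : ℝ, (∀ x, μ * ν x x ≤ h x x) ∧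
      ∃ u : ℕ → X, (∀ n, ν (u n) (u n) = 1) ∧ Tendsto (fun n => h (u n) (u n)) atTop (𝓝 μ) := by
  have normalize : ∀ x ≠ 0, ∃ t : ℝ, t * t * ν x x = 1 := fun x hx =>
    ⟨(√(ν x x))⁻¹, by
      rw [← mul_inv, Real.mul_self_sqrt (ν_pos x hx).le, inv_mul_cancel₀ (ν_pos x hx).ne']⟩
  have smul_smul_form (B : LinearMap.BilinForm ℝ X) (t : ℝ) (x : X) :
      B (t • x) (t • x) = t * t * B x x := by
    simp only [map_smul, LinearMap.smul_apply, smul_eq_mul, mul_assoc]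
  set S : Set ℝ := {r | ∃ x, ν x x = 1 ∧ h x x = r}
  have hne : S.Nonempty := by
    obtain ⟨x, hx⟩ := exists_ne (0 : X)
    obtain ⟨t, ht⟩ := normalize x hx
    exact ⟨_, t • x, by rw [smul_smul_form, ht], rfl⟩
  have hbdd : BddBelow S := by
    refine ⟨-K, ?_⟩
    rintro _ ⟨x, hx, rfl⟩
    linarith [hx ▸ hK x]
  refine ⟨sInf S, fun x => ?_, ?_⟩
  · rcases eq_or_ne x 0 with rfl | hx
    · simp only [map_zero, mul_zero, le_refl]
    obtain ⟨t, ht⟩ := normalize x hx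
    have hle : sInf S ≤ t * t * h x x :=
      csInf_le hbdd ⟨t • x, by rw [smul_smul_form, ht], smul_smul_form h t x⟩
    calc sInf S * ν x x ≤ t * t * h x x * ν x x := by gcongr; exact (ν_pos x hx).le
      _ = t * t * ν x x * h x x := by ring
      _ = h x x := by rw [ht, one_mul]
  · obtain ⟨r, -, hr, hrS⟩ := exists_seq_tendsto_sInf hne hbdd
    choose u hu hur using hrS
    exact ⟨u, hu, by simpa only [hur] using hr⟩

theorem mul_norm_sub_sq_le_of_rayleigh [SeminormedAddCommGroup X] [Module ℝ X]
    {h ν : LinearMap.BilinForm ℝ X} {c K μ : ℝ} (coercive : ∀ x, c * ‖x‖ ^ 2 ≤ h x x + K * ν x x)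
    (hμ : ∀ x, μ * ν x x ≤ h x x) {x y : X} (hx : ν x x = 1) (hy : ν y y = 1) :
    c * ‖x - y‖ ^ 2 ≤ 2 * (h x x - μ) + 2 * (h y y - μ) + (μ + K) * ν (x - y) (x - y) := by
  have parallelogram (B : LinearMap.BilinForm ℝ X) :
      B (x + y) (x + y) + B (x - y) (x - y) = 2 * B x x + 2 * B y y := by
    simp only [map_add, map_sub, LinearMap.add_apply, LinearMap.sub_apply]
    ring
  have hadd := hμ (x + y)
  rw [show ν (x + y) (x + y) = 4 - ν (x - y) (x - y) by linarith [parallelogram ν]] at hadd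
  linarith [coercive (x - y), parallelogram h]

theorem cauchySeq_of_rayleigh [SeminormedAddCommGroup X] [NormedSpace ℝ X] {Z : Type*}
    [SeminormedAddCommGroup Z] [NormedSpace ℝ Z] {J : X →L[ℝ] Z}
    {h ν : LinearMap.BilinForm ℝ X} {c C K μ : ℝ} (hc : 0 < c)
    (coercive : ∀ x, c * ‖x‖ ^ 2 ≤ h x x + K * ν x x) (ν_nonneg : ∀ x, 0 ≤ ν x x)
    (ν_le : ∀ x, ν x x ≤ C * ‖J x‖ ^ 2) (hμ : ∀ x, μ * ν x x ≤ h x x) {u : ℕ → X}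
    (hu : ∀ n, ν (u n) (u n) = 1) (hlim : Tendsto (fun n => h (u n) (u n)) atTop (𝓝 μ))
    (hJ : CauchySeq fun n => J (u n)) : CauchySeq u := by
  have hJu : Tendsto (fun p : ℕ × ℕ => ‖J (u p.1) - J (u p.2)‖) atTop (𝓝 0) := by
    simpa only [dist_eq_norm] using cauchySeq_iff_tendsto_dist_atTop_0.1 hJ
  have hfst : Tendsto (fun p : ℕ × ℕ => h (u p.1) (u p.1) - μ) atTop (𝓝 0) := by
    simpa [← prod_atTop_atTop_eq] using (hlim.comp tendsto_fst).sub_const μ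
  have hsnd : Tendsto (fun p : ℕ × ℕ => h (u p.2) (u p.2) - μ) atTop (𝓝 0) := by
    simpa [← prod_atTop_atTop_eq] using (hlim.comp tendsto_snd).sub_const μ
  have hbound : ∀ p : ℕ × ℕ, c * ‖u p.1 - u p.2‖ ^ 2 ≤ 2 * (h (u p.1) (u p.1) - μ) +
      2 * (h (u p.2) (u p.2) - μ) + |μ + K| * (C * ‖J (u p.1) - J (u p.2)‖ ^ 2) := by
    intro p
    refine (mul_norm_sub_sq_le_of_rayleigh coercive hμ (hu p.1) (hu p.2)).trans ?_
    gcongr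
    · exact ν_nonneg _
    · exact le_abs_self _
    · simpa only [map_sub] using ν_le (u p.1 - u p.2)
  have hsq : Tendsto (fun p : ℕ × ℕ => c * ‖u p.1 - u p.2‖ ^ 2) atTop (𝓝 0) := by
    refine squeeze_zero (fun p => by positivity) hbound ?_
    simpa using ((hfst.const_mul 2).add (hsnd.const_mul 2)).add
      (((hJu.pow 2).const_mul C).const_mul |μ + K|)
  rw [cauchySeq_iff_tendsto_dist_atTop_0]
  have := (hsq.const_mul c⁻¹).sqrt
  simp only [mul_zero, Real.sqrt_zero] at this
  refine this.congr fun p => ?_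
  rw [inv_mul_cancel_left₀ hc.ne', Real.sqrt_sq (norm_nonneg _), dist_eq_norm]

/-- The direct method: along a subsequence of a minimizing sequence the images under `J`
converge, and then the parallelogram identity makes that subsequence itself Cauchy. -/
theorem exists_rayleigh_minimizer [NormedAddCommGroup X] [NormedSpace ℝ X] [CompleteSpace X]
    [Nontrivial X] {Z : Type*} [NormedAddCommGroup Z] [NormedSpace ℝ Z] {J : X →L[ℝ] Z}
    (hJ : IsCompactOperator J) {h ν : LinearMap.BilinForm ℝ X}
    (h_cont : Continuous fun x => h x x) (ν_cont : Continuous fun x => ν x x)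
    (ν_pos : ∀ x ≠ 0, 0 < ν x x) {c C K : ℝ} (hc : 0 < c)
    (coercive : ∀ x, c * ‖x‖ ^ 2 ≤ h x x + K * ν x x) (ν_le : ∀ x, ν x x ≤ C * ‖J x‖ ^ 2) :
    ∃ x ≠ 0, ∀ y, h x x * ν y y ≤ h y y * ν x x := by
  have ν_nonneg : ∀ x, 0 ≤ ν x x := fun x => by
    rcases eq_or_ne x 0 with rfl | hx
    · simp only [map_zero, le_refl]
    · exact (ν_pos x hx).le
  obtain ⟨μ, hμ, u, hu, hlim⟩ := exists_rayleigh_minimizing_seq ν_pos fun x =>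
    (by positivity : 0 ≤ c * ‖x‖ ^ 2).trans (coercive x)
  obtain ⟨D, hD⟩ := hlim.bddAbove_range
  have hbdd : ∀ n, ‖u n‖ ≤ √((D + K) / c) := fun n => by
    refine Real.le_sqrt_of_sq_le ((le_div_iff₀' hc).2 ?_)
    have := hu n ▸ coercive (u n)
    linarith [hD (mem_range_self n)]
  obtain ⟨z, -, φ, hφ, hz⟩ := (hJ.isCompact_closure_image_closedBall _).tendsto_subseq fun n =>
    subset_closure (mem_image_of_mem J (mem_closedBall_zero_iff.2 (hbdd n)))
  have hlim' := hlim.comp hφ.tendsto_atTop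
  obtain ⟨x, hx⟩ := cauchySeq_tendsto_of_complete <|
    cauchySeq_of_rayleigh hc coercive ν_nonneg ν_le hμ (fun n => hu (φ n)) hlim' hz.cauchySeq
  have hhx : h x x = μ := tendsto_nhds_unique ((h_cont.tendsto x).comp hx) hlim'
  have hνx : ν x x = 1 := tendsto_nhds_unique ((ν_cont.tendsto x).comp hx) <|
    tendsto_const_nhds.congr fun n => (hu (φ n)).symm
  refine ⟨x, fun h0 => ?_, fun y => ?_⟩
  · simp [h0] at hνx
  · rw [hhx, hνx, mul_one]
    exact hμ y

end Rayleigh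

section Compactness

open Filter Topology

theorem isCompactOperator_of_dist_le {X α : Type*} [NormedAddCommGroup X] [NormedSpace ℝ X]
    [PseudoMetricSpace α] [CompactSpace α] (T : X →L[ℝ] C(α, ℝ)) {ω : ℝ → ℝ}
    (hω : Tendsto ω (𝓝 0) (𝓝 0)) (h : ∀ x s t, dist (T x s) (T x t) ≤ ‖x‖ * ω (dist s t)) :
    IsCompactOperator T := by
  let e := ContinuousMap.isometryEquivBoundedOfCompact α ℝ
  have hcompact : IsCompact (closure ((fun x => e (T x)) '' Metric.closedBall 0 1)) := by
    refine BoundedContinuousFunction.arzela_ascoli (Metric.closedBall 0 ‖T‖)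
      (isCompact_closedBall _ _) _ ?_ (fun s => ?_)
    · rintro _ s ⟨x, hx, rfl⟩
      rw [mem_closedBall_zero_iff] at hx ⊢
      exact ((T x).norm_coe_le_norm s).trans (T.unit_le_opNorm x hx)
    · refine Metric.equicontinuousAt_of_continuity_modulus (fun t => |ω (dist s t)|) ?_ _
        (.of_forall ?_)
      · have hdist : Tendsto (fun t => dist s t) (𝓝 s) (𝓝 0) := by
          simpa only [dist_self] using
            (continuous_const.dist continuous_id : Continuous (dist s)).tendsto s
        simpa only [abs_zero, Function.comp_def] using (hω.comp hdist).abs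
      · rintro t ⟨_, x, hx, rfl⟩
        rw [mem_closedBall_zero_iff] at hx
        calc dist (T x s) (T x t) ≤ ‖x‖ * ω (dist s t) := h x s t
          _ ≤ ‖x‖ * |ω (dist s t)| := by gcongr; exact le_abs_self _
          _ ≤ |ω (dist s t)| := mul_le_of_le_one_left (abs_nonneg _) hx
  refine ⟨_, hcompact.image e.symm.continuous,
    mem_of_superset (Metric.closedBall_mem_nhds 0 one_pos) fun x hx => ?_⟩
  exact ⟨_, subset_closure ⟨x, hx, rfl⟩, e.symm_apply_apply _⟩

theorem isCompactOperator_pi {ι X : Type*} {Z : ι → Type*} [Finite ι] [Zero X]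
    [TopologicalSpace X] [∀ i, TopologicalSpace (Z i)] {T : X → ∀ i, Z i}
    (h : ∀ i, IsCompactOperator fun x => T x i) : IsCompactOperator T := by
  choose K hK hT using h
  exact ⟨univ.pi K, isCompact_univ_pi hK,
    mem_of_superset (iInter_mem.2 hT) fun x hx i _ => mem_iInter.1 hx i⟩

end Compactness

section Primitive

variable {a b : ℝ}

theorem integral_toLp {f : ℝ → ℝ} (hf : MemLp f 2 (volume.restrict (Icc a b))) {x : ℝ}
    (hx : x ∈ Icc a b) : ∫ t in a..x, hf.toLp f t = ∫ t in a..x, f t := by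
  rw [intervalIntegral.integral_of_le hx.1, intervalIntegral.integral_of_le hx.1]
  exact integral_congr_ae (ae_mono (Measure.restrict_mono
    (Ioc_subset_Icc_self.trans (Icc_subset_Icc_right hx.2)) le_rfl) hf.coeFn_toLp)

theorem integral_eq_inner_indicatorConstLp (F : Lp ℝ 2 (volume.restrict (Icc a b))) {x y : ℝ}
    (hx : x ∈ Icc a b) (hy : y ∈ Icc a b) (hxy : x ≤ y) :
    ∫ t in x..y, F t = inner ℝ (indicatorConstLp 2 (measurableSet_Ioc (a := x) (b := y))
      (measure_ne_top (volume.restrict (Icc a b)) _) (1 : ℝ)) F := by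
  rw [L2.inner_indicatorConstLp_one, intervalIntegral.integral_of_le hxy,
    Measure.restrict_restrict measurableSet_Ioc, inter_eq_left.2]
  exact Ioc_subset_Icc_self.trans (Icc_subset_Icc hx.1 hy.2)

theorem abs_primitive_sub_le (F : Lp ℝ 2 (volume.restrict (Icc a b))) {x y : ℝ}
    (hx : x ∈ Icc a b) (hy : y ∈ Icc a b) :
    |(∫ t in a..x, F t) - ∫ t in a..y, F t| ≤ ‖F‖ * √|x - y| := by
  wlog hxy : y ≤ x generalizing x y
  · rw [abs_sub_comm, abs_sub_comm x]
    exact this hy hx (le_of_not_ge hxy)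
  have hab : a ≤ b := hx.1.trans hx.2
  have hF : ∀ z ∈ Icc a b, IntervalIntegrable F volume a z := fun z hz =>
    (intervalIntegrable_of_memLp_two hab (Lp.memLp F)).mono_set <| by
      simpa only [uIcc_of_le hab, uIcc_of_le hz.1] using Icc_subset_Icc_right hz.2
  rw [intervalIntegral.integral_interval_sub_left (hF x hx) (hF y hy),
    integral_eq_inner_indicatorConstLp F hy hx hxy, mul_comm]
  refine (abs_real_inner_le_norm _ _).trans ?_
  gcongr
  rw [norm_indicatorConstLp two_ne_zero ENNReal.ofNat_ne_top, norm_one, one_mul, Real.sqrt_eq_rpow,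
    measureReal_restrict_apply measurableSet_Ioc, inter_eq_left.2
      (Ioc_subset_Icc_self.trans (Icc_subset_Icc hy.1 hx.2)), Real.volume_real_Ioc,
    abs_of_nonneg (sub_nonneg.2 hxy), max_eq_left (sub_nonneg.2 hxy), ENNReal.toReal_ofNat]

/-- The primitive vanishing at `a`, as an operator from `L²(a, b)` to `C([a, b])`. -/
noncomputable def primitiveCLM (a b : ℝ) :
    Lp ℝ 2 (volume.restrict (Icc a b)) →L[ℝ] C(Icc a b, ℝ) :=
  LinearMap.mkContinuous
    { toFun := fun F => ⟨fun x => ∫ t in a..x, F t, by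
        refine continuous_iff_continuousAt.2 fun x => tendsto_iff_dist_tendsto_zero.2 ?_
        refine squeeze_zero (fun _ => dist_nonneg) (fun y => abs_primitive_sub_le F y.2 x.2) ?_
        have hcont : Continuous fun y : Icc a b => ‖F‖ * √|(y : ℝ) - x| := by fun_prop
        simpa using hcont.tendsto x⟩
      map_add' := fun F G => by
        ext x
        have ha : a ∈ Icc a b := left_mem_Icc.2 (x.2.1.trans x.2.2)
        simp only [ContinuousMap.coe_mk, ContinuousMap.add_apply,
          integral_eq_inner_indicatorConstLp _ ha x.2 x.2.1, inner_add_right]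
      map_smul' := fun c F => by
        ext x
        have ha : a ∈ Icc a b := left_mem_Icc.2 (x.2.1.trans x.2.2)
        simp only [ContinuousMap.coe_mk, ContinuousMap.smul_apply, RingHom.id_apply,
          integral_eq_inner_indicatorConstLp _ ha x.2 x.2.1, inner_smul_right, smul_eq_mul] }
    √(b - a) fun F => by
      refine (ContinuousMap.norm_le _ (by positivity)).2 fun x => ?_
      have hbound := abs_primitive_sub_le F x.2 (left_mem_Icc.2 (x.2.1.trans x.2.2))
      rw [intervalIntegral.integral_same, sub_zero, abs_of_nonneg (sub_nonneg.2 x.2.1)] at hbound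
      refine hbound.trans ?_
      rw [mul_comm]
      gcongr
      exact x.2.2

theorem primitiveCLM_apply (F : Lp ℝ 2 (volume.restrict (Icc a b))) (x : Icc a b) :
    primitiveCLM a b F x = ∫ t in a..x, F t := rfl

theorem primitiveCLM_injective (hab : a ≤ b) : Function.Injective (primitiveCLM a b) := by
  refine (injective_iff_map_eq_zero _).2 fun F h => ?_
  have hF : IsAC a b (fun x => ∫ t in a..x, F t) F :=
    ⟨intervalIntegrable_of_memLp_two hab (Lp.memLp F), fun x _ => by simp⟩
  have hzero : IsAC a b (fun x => ∫ t in a..x, F t) 0 :=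
    ⟨intervalIntegrable_const, fun x hx => by
      simpa [primitiveCLM_apply] using DFunLike.congr_fun h ⟨x, hx⟩⟩
  rw [Lp.eq_zero_iff_ae_eq_zero]
  filter_upwards [hF.ae_hasDerivAt hab, hzero.ae_hasDerivAt hab] with x hx hx0
  exact hx.unique hx0

theorem isCompactOperator_primitiveCLM (a b : ℝ) : IsCompactOperator (primitiveCLM a b) := by
  refine isCompactOperator_of_dist_le _ (ω := Real.sqrt) ?_ fun F x y =>
    abs_primitive_sub_le F x.2 y.2
  simpa only [Real.sqrt_zero] using Real.continuous_sqrt.tendsto 0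

theorem continuous_integral_mul_IccExtend (hab : a ≤ b) {q : ℝ → ℝ}
    (hq : IntervalIntegrable q volume a b) :
    Continuous fun w : C(Icc a b, ℝ) => ∫ t in a..b, q t * IccExtend hab w t := by
  have hf_int : ∀ w : C(Icc a b, ℝ),
      IntervalIntegrable (fun t => q t * IccExtend hab w t) volume a b :=
    fun w => hq.mul_continuousOn w.continuous.Icc_extend'.continuousOn
  refine (LipschitzWith.of_dist_le_mul (K := Real.toNNReal (∫ t in a..b, |q t|))
    fun w z => ?_).continuous
  rw [Real.dist_eq, ← intervalIntegral.integral_sub (hf_int w) (hf_int z), Real.coe_toNNReal _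
    (intervalIntegral.integral_nonneg hab fun t _ => abs_nonneg _),
    ← intervalIntegral.integral_mul_const]
  refine (intervalIntegral.abs_integral_le_integral_abs hab).trans ?_
  refine intervalIntegral.integral_mono_on hab ((hf_int w).sub (hf_int z)).norm
    (hq.norm.mul_const _) fun t _ => ?_
  rw [← mul_sub, abs_mul]
  exact mul_le_mul_of_nonneg_left
    (ContinuousMap.dist_apply_le_dist (f := w) (g := z) (projIcc a b hab t)) (abs_nonneg _)

end Primitive

/-! ### The form of the Hamiltonian -/

namespace QuantumGraph

variable {V E : Type*} (G : QuantumGraph V E)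

theorem memLp_top_pot (e : E) : MemLp (G.pot e) ⊤ (volume.restrict (Icc (G.lo e) (G.hi e))) := by
  obtain ⟨M, hM⟩ := G.pot_bounded e
  obtain ⟨S, hS⟩ := G.pot_piecewise e
  have hmeas := hS.aestronglyMeasurable (μ := volume)
    (measurableSet_Icc.diff S.finite_toSet.measurableSet)
  rw [Measure.restrict_congr_set
    (sdiff_null_ae_eq_self (S.finite_toSet.measure_zero volume))] at hmeas
  exact memLp_top_of_bound hmeas M ((ae_restrict_iff' measurableSet_Icc).2 (.of_forall hM))

theorem intervalIntegrable_pot (e : E) :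
    IntervalIntegrable (G.pot e) volume (G.lo e) (G.hi e) := by
  rw [intervalIntegrable_iff_integrableOn_Icc_of_le (G.lo_lt_hi e).le]
  exact (G.memLp_top_pot e).integrable le_top

/-- The coefficient of the vertex condition, with the value zero at the Dirichlet vertices. -/
noncomputable def strength (v : V) : ℝ := (G.coupling v).untopD 0

section IntegralForm

variable [Fintype E] {M : Type*} [AddCommGroup M] [Module ℝ M]

/-- The bilinear form `∑ e, ∫ w e x * u e y` on a space `M` of functions on the edges; the forms of
the Hamiltonian are assembled from such sums. -/
noncomputable def integralForm (w u : E → M →ₗ[ℝ] ℝ → ℝ)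
    (h : ∀ e x y, IntervalIntegrable (fun t => w e x t * u e y t) volume (G.lo e) (G.hi e)) :
    LinearMap.BilinForm ℝ M :=
  LinearMap.mk₂ ℝ (fun x y => ∑ e, ∫ t in (G.lo e)..(G.hi e), w e x t * u e y t)
    (fun x x' y => by
      simp only [map_add, Pi.add_apply, add_mul, ← Finset.sum_add_distrib]
      exact Finset.sum_congr rfl fun e _ => intervalIntegral.integral_add (h e x y) (h e x' y))
    (fun c x y => by
      simp only [map_smul, Pi.smul_apply, smul_eq_mul, mul_assoc, Finset.mul_sum,
        intervalIntegral.integral_const_mul])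
    (fun x y y' => by
      simp only [map_add, Pi.add_apply, mul_add, ← Finset.sum_add_distrib]
      exact Finset.sum_congr rfl fun e _ => intervalIntegral.integral_add (h e x y) (h e x y'))
    (fun c x y => by
      simp only [map_smul, Pi.smul_apply, smul_eq_mul, mul_left_comm _ c, Finset.mul_sum,
        intervalIntegral.integral_const_mul])

end IntegralForm

variable [Fintype E]

open Classical in
/-- The vertices that are ends of edges. -/
noncomputable def ends : Finset V := Finset.univ.image G.src ∪ Finset.univ.image G.tgt

theorem mem_ends {v : V} : v ∈ G.ends ↔ ∃ e, G.src e = v ∨ G.tgt e = v := by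
  classical
  simp [ends, exists_or]

theorem src_mem_ends (e : E) : G.src e ∈ G.ends := G.mem_ends.2 ⟨e, .inl rfl⟩

theorem tgt_mem_ends (e : E) : G.tgt e ∈ G.ends := G.mem_ends.2 ⟨e, .inr rfl⟩

/-- The form domain of the Hamiltonian. Its elements are triples `(f, f', φ)` consisting of a
function of class `H¹` on the edges, its weak derivative and its vertex values; these vanish at the
Dirichlet vertices, and by convention also at the isolated vertices. -/
def formDomain : Submodule ℝ ((E → ℝ → ℝ) × (E → ℝ → ℝ) × (V → ℝ)) where
  carrier := {x | (∀ e, IsH1 (G.lo e) (G.hi e) (x.1 e) (x.2.1 e)) ∧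
    (∀ e, x.1 e (G.lo e) = x.2.2 (G.src e) ∧ x.1 e (G.hi e) = x.2.2 (G.tgt e)) ∧
    ∀ v, (G.coupling v = ⊤ ∨ v ∉ G.ends) → x.2.2 v = 0}
  add_mem' := by
    rintro x y ⟨hx, hx', hx''⟩ ⟨hy, hy', hy''⟩
    exact ⟨fun e => (hx e).add (hy e), fun e => by simp [hx' e, hy' e],
      fun v hv => by simp [hx'' v hv, hy'' v hv]⟩
  zero_mem' := ⟨fun e => ⟨MemLp.zero, fun t _ => by simp⟩, fun e => by simp, fun v _ => by simp⟩
  smul_mem' := by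
    rintro c x ⟨hx, hx', hx''⟩
    exact ⟨fun e => (hx e).const_mul c, fun e => by simp [hx' e], fun v hv => by simp [hx'' v hv]⟩

section

variable {G}

theorem memLp_deriv (x : G.formDomain) (e : E) :
    MemLp (x.1.2.1 e) 2 (volume.restrict (Icc (G.lo e) (G.hi e))) := (x.2.1 e).memLp

theorem continuousOn_value (x : G.formDomain) (e : E) :
    ContinuousOn (x.1.1 e) (Icc (G.lo e) (G.hi e)) := (x.2.1 e).continuousOn

theorem memLp_value (x : G.formDomain) (e : E) :
    MemLp (x.1.1 e) 2 (volume.restrict (Icc (G.lo e) (G.hi e))) :=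
  memLp_two_of_continuousOn_Icc (continuousOn_value x e)

theorem intervalIntegrable_deriv_mul_deriv (x y : G.formDomain) (e : E) :
    IntervalIntegrable (fun t => x.1.2.1 e t * y.1.2.1 e t) volume (G.lo e) (G.hi e) :=
  intervalIntegrable_mul_of_memLp_two (G.lo_lt_hi e).le (memLp_deriv x e) (memLp_deriv y e)

theorem intervalIntegrable_value_mul_value (x y : G.formDomain) (e : E) :
    IntervalIntegrable (fun t => x.1.1 e t * y.1.1 e t) volume (G.lo e) (G.hi e) :=
  intervalIntegrable_mul_of_memLp_two (G.lo_lt_hi e).le (memLp_value x e) (memLp_value y e)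

theorem intervalIntegrable_pot_mul_value_mul_value (x y : G.formDomain) (e : E) :
    IntervalIntegrable (fun t => G.pot e t * x.1.1 e t * y.1.1 e t) volume (G.lo e) (G.hi e) :=
  intervalIntegrable_mul_of_memLp_two (G.lo_lt_hi e).le
    ((memLp_value x e).mul (G.memLp_top_pot e)) (memLp_value y e)

end

/-- The linear map taking an element of the form domain to its function on the edge `e`. -/
def valueMap (e : E) : G.formDomain →ₗ[ℝ] ℝ → ℝ :=
  LinearMap.proj e ∘ₗ LinearMap.fst ℝ _ _ ∘ₗ G.formDomain.subtype

/-- The linear map taking an element of the form domain to its weak derivative on the edge `e`. -/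
def derivMap (e : E) : G.formDomain →ₗ[ℝ] ℝ → ℝ :=
  LinearMap.proj e ∘ₗ LinearMap.fst ℝ _ _ ∘ₗ LinearMap.snd ℝ _ _ ∘ₗ G.formDomain.subtype

/-- The linear map taking an element of the form domain to its value at the vertex `v`. -/
def vertexMap (v : V) : G.formDomain →ₗ[ℝ] ℝ :=
  LinearMap.proj v ∘ₗ LinearMap.snd ℝ _ _ ∘ₗ LinearMap.snd ℝ _ _ ∘ₗ G.formDomain.subtype

/-- The scalar product of `L²` on the form domain. -/
noncomputable def massForm : LinearMap.BilinForm ℝ G.formDomain :=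
  G.integralForm G.valueMap G.valueMap fun e x y => intervalIntegrable_value_mul_value x y e

/-- The Dirichlet form, the scalar product in `L²` of the derivatives. -/
noncomputable def dirichletForm : LinearMap.BilinForm ℝ G.formDomain :=
  G.integralForm G.derivMap G.derivMap fun e x y => intervalIntegrable_deriv_mul_deriv x y e

/-- The contribution of the potential to the form of the Hamiltonian. -/
noncomputable def potentialForm : LinearMap.BilinForm ℝ G.formDomain :=
  G.integralForm (fun e => LinearMap.mulLeft ℝ (G.pot e) ∘ₗ G.valueMap e) G.valueMap
    fun e x y => intervalIntegrable_pot_mul_value_mul_value x y e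

/-- The contribution of the vertex conditions to the form of the Hamiltonian. -/
noncomputable def vertexForm : LinearMap.BilinForm ℝ G.formDomain :=
  ∑ v ∈ G.ends, G.strength v • LinearMap.BilinForm.linMulLin (G.vertexMap v) (G.vertexMap v)

/-- The bilinear form of the Hamiltonian. -/
noncomputable def energyForm : LinearMap.BilinForm ℝ G.formDomain :=
  G.dirichletForm + G.potentialForm + G.vertexForm

theorem massForm_apply (x y : G.formDomain) :
    G.massForm x y = ∑ e, ∫ t in (G.lo e)..(G.hi e), x.1.1 e t * y.1.1 e t := rfl

theorem dirichletForm_apply (x y : G.formDomain) :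
    G.dirichletForm x y = ∑ e, ∫ t in (G.lo e)..(G.hi e), x.1.2.1 e t * y.1.2.1 e t := rfl

theorem potentialForm_apply (x y : G.formDomain) :
    G.potentialForm x y =
      ∑ e, ∫ t in (G.lo e)..(G.hi e), G.pot e t * x.1.1 e t * y.1.1 e t := rfl

theorem vertexForm_apply (x y : G.formDomain) :
    G.vertexForm x y = ∑ v ∈ G.ends, G.strength v * (x.1.2.2 v * y.1.2.2 v) := by
  simp only [vertexForm, LinearMap.sum_apply, LinearMap.smul_apply,
    LinearMap.BilinForm.linMulLin_apply, smul_eq_mul]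
  rfl

theorem energyForm_apply (x y : G.formDomain) :
    G.energyForm x y = G.dirichletForm x y + G.potentialForm x y + G.vertexForm x y := rfl

theorem massForm_isSymm : G.massForm.IsSymm :=
  ⟨fun x y => by simp only [massForm_apply, mul_comm]⟩

theorem energyForm_isSymm : G.energyForm.IsSymm :=
  ⟨fun x y => by
    simp only [energyForm_apply, dirichletForm_apply, potentialForm_apply, vertexForm_apply,
      mul_assoc, mul_comm (x.1.1 _ _), mul_comm (x.1.2.1 _ _),
      mul_comm (x.1.2.2 _)]⟩

variable {G}

theorem massForm_nonneg (x : G.formDomain) : 0 ≤ G.massForm x x :=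
  Finset.sum_nonneg fun e _ => intervalIntegral.integral_nonneg (G.lo_lt_hi e).le
    fun _ _ => mul_self_nonneg _

theorem massForm_pos {x : G.formDomain}
    (hne : ∃ e, ∃ t ∈ Icc (G.lo e) (G.hi e), x.1.1 e t ≠ 0) : 0 < G.massForm x x := by
  obtain ⟨e, t, ht, hxt⟩ := hne
  refine Finset.sum_pos' (fun e _ => intervalIntegral.integral_nonneg (G.lo_lt_hi e).le
    fun _ _ => mul_self_nonneg _) ⟨e, Finset.mem_univ _, ?_⟩
  exact intervalIntegral.integral_pos (G.lo_lt_hi e)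
    ((continuousOn_value x e).mul (continuousOn_value x e)) (fun _ _ => mul_self_nonneg _)
    ⟨t, ht, mul_self_pos.2 hxt⟩

theorem exists_massForm_pos [Nonempty E] : ∃ x : G.formDomain, 0 < G.massForm x x := by
  obtain ⟨e⟩ := ‹Nonempty E›
  have hd : ∀ e t, HasDerivAt (fun t => (t - G.lo e) * (G.hi e - t)) (G.hi e + G.lo e - 2 * t) t :=
    fun e t => (((hasDerivAt_id t).sub_const (G.lo e)).mul
      ((hasDerivAt_id t).const_sub (G.hi e))).congr_deriv (by simp only [id_eq]; ring)
  refine ⟨⟨(fun e t => (t - G.lo e) * (G.hi e - t), fun e t => G.hi e + G.lo e - 2 * t, 0),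
    fun e => .of_hasDerivAt (hd e) (by fun_prop), fun e => by simp, fun _ _ => rfl⟩,
    massForm_pos ⟨e, (G.lo e + G.hi e) / 2, ?_, ?_⟩⟩
  · constructor <;> linarith [G.lo_lt_hi e]
  · apply ne_of_gt
    apply mul_pos <;> linarith [G.lo_lt_hi e]

end QuantumGraph

/-! ### Coercivity and compactness of the form -/

namespace QuantumGraph

variable {V E : Type*} (G : QuantumGraph V E)

section Bounds

variable [Fintype E]

variable {G} in
theorem dirichletForm_nonneg (x : G.formDomain) : 0 ≤ G.dirichletForm x x :=
  Finset.sum_nonneg fun e _ => intervalIntegral.integral_nonneg (G.lo_lt_hi e).le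
    fun _ _ => mul_self_nonneg _

theorem exists_value_sq_le {ε : ℝ} (hε : 0 < ε) :
    ∃ K, 0 ≤ K ∧ ∀ (x : G.formDomain) e, ∀ t ∈ Icc (G.lo e) (G.hi e),
      x.1.1 e t ^ 2 ≤ ε * G.dirichletForm x x + K * G.massForm x x := by
  choose K hK using fun e => IsH1.exists_sq_le (G.lo_lt_hi e) hε
  have hnonneg : ∀ e (f : ℝ → ℝ), 0 ≤ ∫ t in (G.lo e)..(G.hi e), f t * f t :=
    fun e f => intervalIntegral.integral_nonneg (G.lo_lt_hi e).le fun _ _ => mul_self_nonneg _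
  refine ⟨∑ e, |K e|, Finset.sum_nonneg fun e _ => abs_nonneg _, fun x e t ht => ?_⟩
  have hKe : K e ≤ ∑ e, |K e| := (le_abs_self _).trans
    (Finset.single_le_sum (f := fun e => |K e|) (fun e _ => abs_nonneg _) (Finset.mem_univ e))
  rw [sq, dirichletForm_apply, massForm_apply]
  refine (hK e _ _ (x.2.1 e) t ht).trans (add_le_add (mul_le_mul_of_nonneg_left ?_ hε.le)
    (mul_le_mul hKe ?_ (hnonneg e _) (Finset.sum_nonneg fun e _ => abs_nonneg _)))
  · exact Finset.single_le_sum (fun e _ => hnonneg e (x.1.2.1 e)) (Finset.mem_univ e)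
  · exact Finset.single_le_sum (fun e _ => hnonneg e (x.1.1 e)) (Finset.mem_univ e)

theorem exists_vertex_sq_le {ε : ℝ} (hε : 0 < ε) :
    ∃ K, 0 ≤ K ∧ ∀ (x : G.formDomain) v,
      x.1.2.2 v ^ 2 ≤ ε * G.dirichletForm x x + K * G.massForm x x := by
  obtain ⟨K, hK₀, hK⟩ := G.exists_value_sq_le hε
  refine ⟨K, hK₀, fun x v => ?_⟩
  by_cases hv : v ∈ G.ends
  · obtain ⟨e, rfl | rfl⟩ := G.mem_ends.1 hv
    · rw [← (x.2.2.1 e).1]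
      exact hK x e _ (left_mem_Icc.2 (G.lo_lt_hi e).le)
    · rw [← (x.2.2.1 e).2]
      exact hK x e _ (right_mem_Icc.2 (G.lo_lt_hi e).le)
  · rw [x.2.2.2 v (.inr hv), sq, zero_mul]
    exact add_nonneg (mul_nonneg hε.le (dirichletForm_nonneg x))
      (mul_nonneg hK₀ (massForm_nonneg x))

theorem exists_neg_potentialForm_le :
    ∃ K, ∀ x : G.formDomain, -G.potentialForm x x ≤ K * G.massForm x x := by
  choose M hM using G.pot_bounded
  refine ⟨∑ e, |M e|, fun x => ?_⟩
  rw [potentialForm_apply, massForm_apply, ← Finset.sum_neg_distrib, Finset.mul_sum]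
  refine Finset.sum_le_sum fun e _ => ?_
  rw [← intervalIntegral.integral_neg, ← intervalIntegral.integral_const_mul]
  refine intervalIntegral.integral_mono_on (G.lo_lt_hi e).le
    (intervalIntegrable_pot_mul_value_mul_value x x e).neg
    ((intervalIntegrable_value_mul_value x x e).const_mul _) fun t ht => ?_
  rw [mul_assoc, ← neg_mul]
  refine mul_le_mul_of_nonneg_right ?_ (mul_self_nonneg _)
  calc -G.pot e t ≤ |G.pot e t| := neg_le_abs _
    _ ≤ |M e| := (hM e t ht).trans (le_abs_self _)
    _ ≤ ∑ e, |M e| := Finset.single_le_sum (f := fun e => |M e|) (fun e _ => abs_nonneg _)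
        (Finset.mem_univ e)

theorem exists_dirichletForm_le :
    ∃ K, ∀ x : G.formDomain,
      1 / 2 * G.dirichletForm x x ≤ G.energyForm x x + K * G.massForm x x := by
  obtain ⟨Kp, hKp⟩ := G.exists_neg_potentialForm_le
  set S : ℝ := ∑ v ∈ G.ends, |G.strength v|
  have : 0 ≤ S := Finset.sum_nonneg fun v _ => abs_nonneg _
  obtain ⟨Kv, -, hKv⟩ := G.exists_vertex_sq_le (ε := 1 / (2 * (1 + S))) (by positivity)
  refine ⟨Kp + S * Kv, fun x => ?_⟩
  have hvertex : -G.vertexForm x x ≤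
      S * (1 / (2 * (1 + S)) * G.dirichletForm x x + Kv * G.massForm x x) := by
    rw [vertexForm_apply, ← Finset.sum_neg_distrib, Finset.sum_mul]
    refine Finset.sum_le_sum fun v _ => ?_
    rw [← sq, ← neg_mul]
    exact mul_le_mul (neg_le_abs _) (hKv x v) (sq_nonneg _) (abs_nonneg _)
  have hhalf : S * (1 / (2 * (1 + S))) ≤ 1 / 2 := by
    rw [mul_one_div, div_le_div_iff₀ (by positivity) two_pos]
    linarith
  rw [energyForm_apply]
  nlinarith [hKp x, mul_le_mul_of_nonneg_right hhalf (dirichletForm_nonneg x)]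

end Bounds

section FormSpace

/-- The Banach space in which the form domain is completed: square integrable derivatives on the
edges together with values at the vertices. -/
abbrev DerivData : Type _ :=
  (∀ e, Lp ℝ 2 (volume.restrict (Icc (G.lo e) (G.hi e)))) × (V → ℝ)

/-- The derivative on the edge `e`. -/
noncomputable def derivCLM (e : E) :
    G.DerivData →L[ℝ] Lp ℝ 2 (volume.restrict (Icc (G.lo e) (G.hi e))) :=
  ContinuousLinearMap.proj e ∘L ContinuousLinearMap.fst ℝ _ _

/-- The value at the vertex `v`. -/
noncomputable def vertexCLM (v : V) : G.DerivData →L[ℝ] ℝ :=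
  ContinuousLinearMap.proj v ∘L ContinuousLinearMap.snd ℝ _ _

/-- The continuous function on the edge `e` determined by its derivative and its value at the
initial vertex. -/
noncomputable def edgeFunction (e : E) :
    G.DerivData →L[ℝ] C(Icc (G.lo e) (G.hi e), ℝ) :=
  ContinuousLinearMap.toSpanSingleton ℝ 1 ∘L G.vertexCLM (G.src e) +
    primitiveCLM (G.lo e) (G.hi e) ∘L G.derivCLM e

/-- The continuous functions on all edges determined by their derivatives and by their values at
the vertices; a compact embedding of the form domain. -/
noncomputable def edgeFunctions :
    G.DerivData →L[ℝ] (∀ e, C(Icc (G.lo e) (G.hi e), ℝ)) :=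
  ContinuousLinearMap.pi G.edgeFunction

theorem edgeFunctions_apply (p : G.DerivData) (e : E) (t : Icc (G.lo e) (G.hi e)) :
    G.edgeFunctions p e t = p.2 (G.src e) + ∫ s in (G.lo e)..t, p.1 e s := by
  simp [edgeFunctions, edgeFunction, vertexCLM, derivCLM, primitiveCLM_apply]

theorem isCompactOperator_edgeFunction (e : E) : IsCompactOperator (G.edgeFunction e) := by
  have hconst : IsCompactOperator
      (ContinuousLinearMap.toSpanSingleton ℝ (1 : C(Icc (G.lo e) (G.hi e), ℝ))) :=
    isCompactOperator_of_locallyCompactSpace_rng _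
  exact (hconst.comp_clm (G.vertexCLM (G.src e))).add
    ((isCompactOperator_primitiveCLM (G.lo e) (G.hi e)).comp_clm (G.derivCLM e))

theorem isCompactOperator_edgeFunctions [Finite E] : IsCompactOperator G.edgeFunctions :=
  isCompactOperator_pi G.isCompactOperator_edgeFunction

theorem continuous_integral_mul_edgeFunctions_sq {q : ℝ → ℝ} {e : E}
    (hq : IntervalIntegrable q volume (G.lo e) (G.hi e)) : Continuous fun p : G.DerivData =>
      ∫ t in (G.lo e)..(G.hi e), q t *
        IccExtend (G.lo_lt_hi e).le (G.edgeFunctions p e * G.edgeFunctions p e) t := by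
  have hJ := (continuous_apply e).comp G.edgeFunctions.continuous
  exact (continuous_integral_mul_IccExtend (G.lo_lt_hi e).le hq).comp (hJ.mul hJ)

variable [Fintype E]

/-- The form domain as a closed subspace of a Banach space. -/
noncomputable def formSpace : Submodule ℝ G.DerivData where
  carrier := {p | (∀ e, G.edgeFunctions p e ⟨G.hi e, right_mem_Icc.2 (G.lo_lt_hi e).le⟩ =
      p.2 (G.tgt e)) ∧ ∀ v, (G.coupling v = ⊤ ∨ v ∉ G.ends) → p.2 v = 0}
  add_mem' := by
    rintro p q ⟨hp, hp'⟩ ⟨hq, hq'⟩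
    exact ⟨fun e => by simp [hp e, hq e], fun v hv => by simp [hp' v hv, hq' v hv]⟩
  zero_mem' := by simp
  smul_mem' := by
    rintro c p ⟨hp, hp'⟩
    exact ⟨fun e => by simp [hp e], fun v hv => by simp [hp' v hv]⟩

theorem isClosed_formSpace : IsClosed (G.formSpace : Set G.DerivData) := by
  have hedge : ∀ e, Continuous fun p => G.edgeFunctions p e
      ⟨G.hi e, right_mem_Icc.2 (G.lo_lt_hi e).le⟩ := fun e =>
    (continuous_eval_const _).comp ((continuous_apply e).comp G.edgeFunctions.continuous)
  have hvertex : ∀ v, Continuous fun p : G.DerivData => p.2 v :=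
    fun v => (continuous_apply v).comp continuous_snd
  simp only [formSpace, Submodule.coe_set_mk, AddSubmonoid.coe_set_mk, AddSubsemigroup.coe_set_mk,
    ofPred_and, ofPred_forall]
  exact (isClosed_iInter fun e => isClosed_eq (hedge e) (hvertex _)).inter
    (isClosed_iInter fun v => isClosed_iInter fun _ => isClosed_eq (hvertex v) continuous_const)

variable {G} in
theorem eq_zero_of_edgeFunctions_eq_zero {p : G.formSpace} (h : G.edgeFunctions p.1 = 0) :
    p = 0 := by
  have hsrc : ∀ e, p.1.2 (G.src e) = 0 := fun e => by
    simpa [edgeFunctions_apply] using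
      DFunLike.congr_fun (congrFun h e) ⟨G.lo e, left_mem_Icc.2 (G.lo_lt_hi e).le⟩
  have hvertex : p.1.2 = 0 := by
    ext v
    by_cases hv : v ∈ G.ends
    · obtain ⟨e, rfl | rfl⟩ := G.mem_ends.1 hv
      · exact hsrc e
      · rw [← p.2.1 e, h]
        rfl
    · exact p.2.2 v (.inr hv)
  refine Subtype.ext (Prod.ext (funext fun e => ?_) hvertex)
  refine primitiveCLM_injective (G.lo_lt_hi e).le ?_
  ext t
  have := DFunLike.congr_fun (congrFun h e) t
  rw [edgeFunctions_apply, hsrc, zero_add] at this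
  simpa [primitiveCLM_apply] using this

/-- The map from the form domain to the Banach space `G.formSpace`; it identifies functions that
agree almost everywhere. -/
noncomputable def toFormSpace : G.formDomain →ₗ[ℝ] G.formSpace where
  toFun x := ⟨(fun e => (memLp_deriv x e).toLp, x.1.2.2), fun e => by
    rw [edgeFunctions_apply, ← (x.2.2.1 e).2, ← (x.2.2.1 e).1, (x.2.1 e).integral_deriv _
      (right_mem_Icc.2 (G.lo_lt_hi e).le), integral_toLp _ (right_mem_Icc.2 (G.lo_lt_hi e).le)],
    x.2.2.2⟩
  map_add' x y := Subtype.ext (Prod.ext (funext fun e => rfl) rfl)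
  map_smul' c x := Subtype.ext (Prod.ext (funext fun e => rfl) rfl)

theorem edgeFunctions_toFormSpace (x : G.formDomain) (e : E) (t : Icc (G.lo e) (G.hi e)) :
    G.edgeFunctions (G.toFormSpace x).1 e t = x.1.1 e t := by
  rw [edgeFunctions_apply, (x.2.1 e).integral_deriv t t.2, (x.2.2.1 e).1,
    ← integral_toLp (memLp_deriv x e) t.2]
  rfl

theorem toFormSpace_surjective : Function.Surjective G.toFormSpace := by
  intro p
  refine ⟨⟨(fun e t => p.1.2 (G.src e) + ∫ s in (G.lo e)..t, p.1.1 e s, fun e => p.1.1 e, p.1.2),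
    fun e => ⟨Lp.memLp _, fun t _ => by simp⟩, fun e => ⟨by simp, ?_⟩, p.2.2⟩, ?_⟩
  · rw [← p.2.1 e, edgeFunctions_apply]
  · exact Subtype.ext (Prod.ext (funext fun e => Lp.toLp_coeFn (p.1.1 e) (Lp.memLp _)) rfl)

theorem exists_toFormSpace_rightInverse :
    ∃ s : G.formSpace →ₗ[ℝ] G.formDomain, ∀ p, G.toFormSpace (s p) = p := by
  have : Module.Free ℝ G.formSpace := Module.Free.of_divisionRing ..
  have : Module.Projective ℝ G.formSpace := Module.Projective.of_free
  exact (LinearMap.exists_rightInverse_of_surjective G.toFormSpace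
    (LinearMap.range_eq_top.2 G.toFormSpace_surjective)).imp fun s hs => LinearMap.congr_fun hs

theorem dirichletForm_eq_sum_norm_sq (x : G.formDomain) :
    G.dirichletForm x x = ∑ e, ‖(G.toFormSpace x).1.1 e‖ ^ 2 := by
  rw [dirichletForm_apply]
  refine Finset.sum_congr rfl fun e _ => ?_
  rw [← real_inner_self_eq_norm_sq, L2.inner_def,
    intervalIntegral.integral_of_le (G.lo_lt_hi e).le, ← integral_Icc_eq_integral_Ioc]
  refine integral_congr_ae ((memLp_deriv x e).coeFn_toLp.mono fun t ht => ?_)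
  exact congrArg₂ (· * ·) ht.symm ht.symm

theorem norm_sq_toFormSpace_le [Fintype V] {c : ℝ} {x : G.formDomain}
    (hD : G.dirichletForm x x ≤ c) (hV : ∀ v, x.1.2.2 v ^ 2 ≤ c) :
    ‖G.toFormSpace x‖ ^ 2 ≤ c := by
  have hc : 0 ≤ c := (dirichletForm_nonneg x).trans hD
  rw [dirichletForm_eq_sum_norm_sq] at hD
  refine (Real.le_sqrt (norm_nonneg _) hc).1 (norm_prod_le_iff.2
    ⟨(pi_norm_le_iff_of_nonneg (Real.sqrt_nonneg c)).2 fun e => Real.le_sqrt_of_sq_le ?_,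
      (pi_norm_le_iff_of_nonneg (Real.sqrt_nonneg c)).2 fun v => Real.abs_le_sqrt (hV v)⟩)
  exact (Finset.single_le_sum (f := fun e => ‖(G.toFormSpace x).1.1 e‖ ^ 2)
    (fun e _ => sq_nonneg _) (Finset.mem_univ e)).trans hD

theorem massForm_le_norm_edgeFunctions_sq (x : G.formDomain) :
    G.massForm x x ≤ (∑ e, (G.hi e - G.lo e)) * ‖G.edgeFunctions (G.toFormSpace x).1‖ ^ 2 := by
  rw [massForm_apply, Finset.sum_mul]
  refine Finset.sum_le_sum fun e _ => ?_
  rw [← smul_eq_mul, ← intervalIntegral.integral_const]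
  refine intervalIntegral.integral_mono_on (G.lo_lt_hi e).le
    (intervalIntegrable_value_mul_value x x e) intervalIntegrable_const fun t ht => ?_
  rw [← sq, ← sq_abs, ← G.edgeFunctions_toFormSpace x e ⟨t, ht⟩]
  exact pow_le_pow_left₀ (abs_nonneg _) (((G.edgeFunctions _ e).norm_coe_le_norm _).trans
    (norm_le_pi_norm _ e)) 2

theorem IccExtend_edgeFunctions_sq (x : G.formDomain) (e : E) {t : ℝ}
    (ht : t ∈ Icc (G.lo e) (G.hi e)) :
    IccExtend (G.lo_lt_hi e).le
      (G.edgeFunctions (G.toFormSpace x).1 e * G.edgeFunctions (G.toFormSpace x).1 e) t =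
      x.1.1 e t * x.1.1 e t := by
  rw [IccExtend_of_mem _ _ ht, ContinuousMap.mul_apply, edgeFunctions_toFormSpace]

theorem exists_continuous_sum_integral_eq {q : E → ℝ → ℝ}
    (hq : ∀ e, IntervalIntegrable (q e) volume (G.lo e) (G.hi e)) :
    ∃ M : G.formSpace → ℝ, Continuous M ∧ ∀ x : G.formDomain,
      ∑ e, ∫ t in (G.lo e)..(G.hi e), q e t * (x.1.1 e t * x.1.1 e t) = M (G.toFormSpace x) := by
  refine ⟨fun p => ∑ e, ∫ t in (G.lo e)..(G.hi e), q e t *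
    IccExtend (G.lo_lt_hi e).le (G.edgeFunctions p.1 e * G.edgeFunctions p.1 e) t,
    continuous_finsetSum Finset.univ fun e _ =>
      (G.continuous_integral_mul_edgeFunctions_sq (hq e)).comp continuous_subtype_val,
    fun x => Finset.sum_congr rfl fun e _ => intervalIntegral.integral_congr fun t ht => ?_⟩
  rw [uIcc_of_le (G.lo_lt_hi e).le] at ht
  simp only [G.IccExtend_edgeFunctions_sq x e ht]

theorem exists_continuous_massForm_eq : ∃ M : G.formSpace → ℝ, Continuous M ∧
    ∀ x, G.massForm x x = M (G.toFormSpace x) := by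
  obtain ⟨M, hM, hM'⟩ := G.exists_continuous_sum_integral_eq (q := 1)
    fun _ => intervalIntegrable_const
  exact ⟨M, hM, fun x => by simp only [massForm_apply, ← hM', Pi.one_apply, one_mul]⟩

theorem exists_continuous_energyForm_eq : ∃ H : G.formSpace → ℝ, Continuous H ∧
    ∀ x, G.energyForm x x = H (G.toFormSpace x) := by
  obtain ⟨W, hW, hW'⟩ := G.exists_continuous_sum_integral_eq G.intervalIntegrable_pot
  refine ⟨fun p => ∑ e, ‖p.1.1 e‖ ^ 2 + W p + ∑ v ∈ G.ends, G.strength v * (p.1.2 v * p.1.2 v),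
    ?_, fun x => ?_⟩
  · fun_prop
  · simp only [energyForm_apply, dirichletForm_eq_sum_norm_sq, ← hW', potentialForm_apply,
      vertexForm_apply, mul_assoc]
    rfl

theorem massForm_pos_of_toFormSpace_ne_zero {x : G.formDomain} (hx : G.toFormSpace x ≠ 0) :
    0 < G.massForm x x := massForm_pos <| by
  by_contra! h
  refine hx (eq_zero_of_edgeFunctions_eq_zero (funext fun e => ContinuousMap.ext fun t => ?_))
  rw [edgeFunctions_toFormSpace]
  exact h e t t.2

theorem nontrivial_formSpace [Nonempty E] : Nontrivial G.formSpace := by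
  obtain ⟨x, hx⟩ := G.exists_massForm_pos
  obtain ⟨M, -, hM⟩ := G.exists_continuous_massForm_eq
  refine ⟨G.toFormSpace x, 0, fun h => hx.ne' ?_⟩
  rw [hM, h, ← map_zero G.toFormSpace, ← hM, map_zero]

theorem exists_norm_sq_toFormSpace_le [Fintype V] : ∃ K, ∀ x : G.formDomain,
    1 / 2 * ‖G.toFormSpace x‖ ^ 2 ≤ G.energyForm x x + K * G.massForm x x := by
  obtain ⟨K, hK⟩ := G.exists_dirichletForm_le
  obtain ⟨L, hL₀, hL⟩ := G.exists_vertex_sq_le one_pos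
  refine ⟨K + L / 2, fun x => ?_⟩
  have hnorm := G.norm_sq_toFormSpace_le
    (le_add_of_nonneg_right (mul_nonneg hL₀ (massForm_nonneg x)))
    fun v => (hL x v).trans_eq (by rw [one_mul])
  linarith [hK x]

end FormSpace

theorem exists_minimizer [Fintype E] [Nonempty E] [Finite V] : ∃ x : G.formDomain,
    0 < G.massForm x x ∧
      ∀ y, G.energyForm x x * G.massForm y y ≤ G.energyForm y y * G.massForm x x := by
  have := Fintype.ofFinite V
  have := G.isClosed_formSpace.completeSpace_coe
  have := G.nontrivial_formSpace
  obtain ⟨M, hM, hM'⟩ := G.exists_continuous_massForm_eq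
  obtain ⟨H, hH, hH'⟩ := G.exists_continuous_energyForm_eq
  obtain ⟨K, hK⟩ := G.exists_norm_sq_toFormSpace_le
  obtain ⟨s, hs⟩ := G.exists_toFormSpace_rightInverse
  have mass_pos : ∀ p ≠ 0, 0 < G.massForm (s p) (s p) := fun p hp =>
    G.massForm_pos_of_toFormSpace_ne_zero (by rwa [hs])
  have coercive : ∀ p, 1 / 2 * ‖p‖ ^ 2 ≤
      G.energyForm (s p) (s p) + K * G.massForm (s p) (s p) := fun p => by
    simpa only [hs] using hK (s p)
  have mass_le : ∀ p, G.massForm (s p) (s p) ≤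
      (∑ e, (G.hi e - G.lo e)) * ‖(G.edgeFunctions ∘L G.formSpace.subtypeL) p‖ ^ 2 := fun p => by
    have := G.massForm_le_norm_edgeFunctions_sq (s p)
    rwa [hs] at this
  obtain ⟨p, hp, hmin⟩ := exists_rayleigh_minimizer
    (h := G.energyForm.compl₁₂ s s) (ν := G.massForm.compl₁₂ s s)
    (G.isCompactOperator_edgeFunctions.comp_clm _)
    (hH.congr fun p => by simp [hH', hs]) (hM.congr fun p => by simp [hM', hs])
    mass_pos one_half_pos coercive mass_le
  refine ⟨s p, mass_pos p hp, fun y => ?_⟩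
  simpa [hH', hM', hs] using hmin (G.toFormSpace y)

end QuantumGraph

/-! ### Weak solutions and the lowest eigenvalue -/

namespace QuantumGraph

variable {V E : Type*} [Fintype E] {G : QuantumGraph V E}

/-- The weak form of the eigenvalue equation together with the vertex conditions. -/
def IsWeakSolution (μ : ℝ) (x : G.formDomain) : Prop :=
  ∀ y, G.energyForm x y = μ * G.massForm x y

theorem isWeakSolution_of_forall_mul_massForm_le {μ : ℝ} {x : G.formDomain}
    (hμ : ∀ y, μ * G.massForm y y ≤ G.energyForm y y)
    (hx : G.energyForm x x = μ * G.massForm x x) : IsWeakSolution μ x := by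
  intro y
  set B : LinearMap.BilinForm ℝ G.formDomain := G.energyForm - μ • G.massForm
  have hB_apply : ∀ u w, B u w = G.energyForm u w - μ * G.massForm u w := fun _ _ => rfl
  have hB_symm : LinearMap.IsSymm B := ⟨fun u w => by
    simp only [hB_apply, G.energyForm_isSymm.eq u w, G.massForm_isSymm.eq u w, RingHom.id_apply]⟩
  have hB_xx : B x x = 0 := by rw [hB_apply, hx, sub_self]
  have hsq := B.apply_sq_le_of_symm (fun u => sub_nonneg.2 (hμ u)) hB_symm x y
  rw [hB_xx, zero_mul] at hsq
  exact sub_eq_zero.1 (pow_eq_zero_iff two_ne_zero |>.1 (hsq.antisymm (sq_nonneg _)))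

theorem sum_integral_eq_neg_sum_outgoingSum {f' f'' : E → ℝ → ℝ}
    (hf : ∀ e, IsH1 (G.lo e) (G.hi e) (f' e) (f'' e)) (y : G.formDomain) :
    ∑ e, (∫ t in (G.lo e)..(G.hi e), (f'' e t * y.1.1 e t + f' e t * y.1.2.1 e t)) =
      -∑ v ∈ G.ends, G.outgoingSum f' v * y.1.2.2 v := by
  classical
  have hedge : ∀ e, ∫ t in (G.lo e)..(G.hi e), (f'' e t * y.1.1 e t + f' e t * y.1.2.1 e t) =
      f' e (G.hi e) * y.1.2.2 (G.tgt e) - f' e (G.lo e) * y.1.2.2 (G.src e) := fun e => by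
    have hle := (G.lo_lt_hi e).le
    rw [((hf e).isAC hle).integral_mul ((y.2.1 e).isAC hle) hle, (y.2.2.1 e).1, (y.2.2.1 e).2]
  simp_rw [hedge, outgoingSum, Finset.sum_mul]
  rw [Finset.sum_comm, ← Finset.sum_neg_distrib]
  refine Finset.sum_congr rfl fun e _ => ?_
  simp_rw [add_mul, ite_mul, zero_mul]
  rw [Finset.sum_add_distrib, Finset.sum_ite_eq, Finset.sum_ite_eq, if_pos (G.src_mem_ends e),
    if_pos (G.tgt_mem_ends e)]
  ring

theorem energyForm_sub_mul_massForm_eq_sum {μ : ℝ} {x : G.formDomain} {f'' : E → ℝ → ℝ}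
    (hx : ∀ e, IsH1 (G.lo e) (G.hi e) (x.1.2.1 e) (f'' e))
    (heq : ∀ e, ∀ᵐ t ∂(volume.restrict (Icc (G.lo e) (G.hi e))),
      -f'' e t + G.pot e t * x.1.1 e t = μ * x.1.1 e t) (y : G.formDomain) :
    G.energyForm x y - μ * G.massForm x y =
      ∑ v ∈ G.ends, (G.strength v * x.1.2.2 v - G.outgoingSum x.1.2.1 v) * y.1.2.2 v := by
  have hedge : ∀ e, (∫ t in (G.lo e)..(G.hi e), x.1.2.1 e t * y.1.2.1 e t) +
      (∫ t in (G.lo e)..(G.hi e), G.pot e t * x.1.1 e t * y.1.1 e t) -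
      μ * (∫ t in (G.lo e)..(G.hi e), x.1.1 e t * y.1.1 e t) =
      ∫ t in (G.lo e)..(G.hi e), (f'' e t * y.1.1 e t + x.1.2.1 e t * y.1.2.1 e t) := fun e => by
    have hderiv := intervalIntegrable_deriv_mul_deriv x y e
    have hpot := intervalIntegrable_pot_mul_value_mul_value x y e
    rw [← intervalIntegral.integral_add hderiv hpot, ← intervalIntegral.integral_const_mul,
      ← intervalIntegral.integral_sub (hderiv.add hpot)
        ((intervalIntegrable_value_mul_value x y e).const_mul μ),
      intervalIntegral.integral_of_le (G.lo_lt_hi e).le,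
      intervalIntegral.integral_of_le (G.lo_lt_hi e).le]
    refine integral_congr_ae ?_
    filter_upwards [ae_mono (Measure.restrict_mono Ioc_subset_Icc_self le_rfl) (heq e)] with t ht
    linear_combination y.1.1 e t * ht
  have hgreen := sum_integral_eq_neg_sum_outgoingSum hx y
  simp only [← hedge, Finset.sum_sub_distrib, Finset.sum_add_distrib, ← Finset.mul_sum] at hgreen
  simp only [sub_mul, Finset.sum_sub_distrib, mul_assoc, energyForm_apply, dirichletForm_apply,
    potentialForm_apply, vertexForm_apply, massForm_apply] at hgreen ⊢
  linarith

namespace IsWeakSolution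

variable {μ : ℝ} {x : G.formDomain}

theorem integral_eq_zero (h : IsWeakSolution μ x) {e : E} {g g' : ℝ → ℝ}
    (hg : IsH1 (G.lo e) (G.hi e) g g') (hlo : g (G.lo e) = 0) (hhi : g (G.hi e) = 0) :
    ∫ t in (G.lo e)..(G.hi e), (x.1.2.1 e t * g' t + (G.pot e t - μ) * x.1.1 e t * g t) = 0 := by
  classical
  let y : G.formDomain := ⟨(Pi.single e g, Pi.single e g', 0), fun e' => by
    rcases eq_or_ne e' e with rfl | hne
    · simpa using hg
    · simpa [hne] using G.formDomain.zero_mem.1 e', fun e' => by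
    rcases eq_or_ne e' e with rfl | hne
    · simp [hlo, hhi]
    · simp [hne], fun _ _ => rfl⟩
  have hderiv := intervalIntegrable_deriv_mul_deriv x y e
  have hpot := intervalIntegrable_pot_mul_value_mul_value x y e
  have hvalue := intervalIntegrable_value_mul_value x y e
  have hxy := h y
  rw [energyForm_apply, dirichletForm_apply, potentialForm_apply, vertexForm_apply, massForm_apply,
    Finset.sum_eq_single e (fun e' _ hne => by simp [y, hne]) (by simp),
    Finset.sum_eq_single e (fun e' _ hne => by simp [y, hne]) (by simp),
    Finset.sum_eq_single e (fun e' _ hne => by simp [y, hne]) (by simp)] at hxy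
  simp only [y, Pi.single_eq_same, Pi.zero_apply, mul_zero, Finset.sum_const_zero, add_zero]
    at hxy hderiv hpot hvalue
  rw [← intervalIntegral.integral_add hderiv hpot, ← intervalIntegral.integral_const_mul,
    ← sub_eq_zero, ← intervalIntegral.integral_sub (hderiv.add hpot) (hvalue.const_mul μ)] at hxy
  rw [← hxy]
  congr 1 with t
  ring

theorem exists_isH1_deriv (h : IsWeakSolution μ x) : ∃ x' : G.formDomain, IsWeakSolution μ x' ∧
    x'.1.1 = x.1.1 ∧ x'.1.2.2 = x.1.2.2 ∧
    ∀ e, IsH1 (G.lo e) (G.hi e) (x'.1.2.1 e) fun t => (G.pot e t - μ) * x.1.1 e t := by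
  have hw : ∀ e, MemLp (fun t => (G.pot e t - μ) * x.1.1 e t) 2
      (volume.restrict (Icc (G.lo e) (G.hi e))) := fun e =>
    (memLp_value x e).mul ((G.memLp_top_pot e).sub (memLp_const μ))
  choose c hc using fun e => (x.2.1 e).exists_ae_eq_primitive (G.lo_lt_hi e)
    (intervalIntegrable_of_memLp_two (G.lo_lt_hi e).le (hw e))
    fun g g' hg hlo hhi => h.integral_eq_zero hg hlo hhi
  have hH1 : ∀ e, IsH1 (G.lo e) (G.hi e)
      (fun t => c e + ∫ s in (G.lo e)..t, (G.pot e s - μ) * x.1.1 e s)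
      (fun t => (G.pot e t - μ) * x.1.1 e t) := fun e => ⟨hw e, fun t _ => by simp⟩
  let x' : G.formDomain :=
    ⟨(x.1.1, fun e t => c e + ∫ s in (G.lo e)..t, (G.pot e s - μ) * x.1.1 e s, x.1.2.2),
      fun e => (x.2.1 e).congr_deriv (hc e), x.2.2.1, x.2.2.2⟩
  refine ⟨x', fun y => (Eq.symm ?_).trans (h y), rfl, rfl, hH1⟩
  have hdirichlet : G.dirichletForm x y = G.dirichletForm x' y := by
    refine Finset.sum_congr rfl fun e _ => ?_
    rw [intervalIntegral.integral_of_le (G.lo_lt_hi e).le,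
      intervalIntegral.integral_of_le (G.lo_lt_hi e).le]
    refine integral_congr_ae ?_
    filter_upwards [ae_mono (Measure.restrict_mono Ioc_subset_Icc_self le_rfl) (hc e)] with t ht
    exact congrArg (· * y.1.2.1 e t) ht
  rw [energyForm_apply, energyForm_apply, hdirichlet, vertexForm_apply, vertexForm_apply]
  rfl

end IsWeakSolution

theorem exists_vertex_eq_single [DecidableEq V] {v : V} (hv : v ∈ G.ends) (hvD : G.coupling v ≠ ⊤) :
    ∃ y : G.formDomain, y.1.2.2 = Pi.single v 1 := by
  set d : V → ℝ := Pi.single v 1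
  refine ⟨⟨(fun e t => d (G.src e) + (d (G.tgt e) - d (G.src e)) / (G.hi e - G.lo e) * (t - G.lo e),
    fun e _ => (d (G.tgt e) - d (G.src e)) / (G.hi e - G.lo e), d), fun e => .linear _ _ _,
    fun e => ⟨by simp, ?_⟩, fun u hu => Pi.single_eq_of_ne ?_ _⟩, rfl⟩
  · simp only [div_mul_cancel₀ _ (sub_ne_zero.2 (G.lo_lt_hi e).ne')]
    ring
  · rintro rfl
    exact hu.elim hvD fun h => h hv

theorem IsWeakSolution.outgoingSum_eq {μ : ℝ} {x : G.formDomain} (h : IsWeakSolution μ x)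
    (hx : ∀ e, IsH1 (G.lo e) (G.hi e) (x.1.2.1 e) fun t => (G.pot e t - μ) * x.1.1 e t)
    {v : V} (hv : v ∈ G.ends) (hvD : G.coupling v ≠ ⊤) :
    G.outgoingSum x.1.2.1 v = G.strength v * x.1.2.2 v := by
  classical
  obtain ⟨y, hy⟩ := exists_vertex_eq_single hv hvD
  have hsum := energyForm_sub_mul_massForm_eq_sum hx (fun e => .of_forall fun t => by ring) y
  rw [h y, sub_self, hy, Finset.sum_eq_single_of_mem v hv
    fun u _ hne => by rw [Pi.single_eq_of_ne hne, mul_zero], Pi.single_eq_same] at hsum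
  linarith

theorem outgoingSum_eq_zero_of_notMem_ends {v : V} (hv : v ∉ G.ends) (f' : E → ℝ → ℝ) :
    G.outgoingSum f' v = 0 := by
  simp only [mem_ends, not_exists, not_or] at hv
  exact Finset.sum_eq_zero fun e _ => by simp only [(hv e).1, (hv e).2, if_false, add_zero]

theorem IsWeakSolution.isEigenvalue {μ : ℝ} {x : G.formDomain} (h : IsWeakSolution μ x)
    (hne : ∃ e, ∃ t ∈ Icc (G.lo e) (G.hi e), x.1.1 e t ≠ 0) : G.IsEigenvalue μ := by
  obtain ⟨x', hx', hvalue, -, hH1⟩ := h.exists_isH1_deriv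
  rw [← hvalue] at hne hH1
  refine ⟨x'.1.1, x'.1.2.1, _, ⟨fun e => ⟨(hH1 e).memLp, (x'.2.1 e).integral_deriv,
    (hH1 e).integral_deriv⟩, x'.1.2.2, x'.2.2.1, fun v hv => x'.2.2.2 v (.inl hv),
    fun v α hα => ?_⟩, hne, fun e => .of_forall fun t => by ring⟩
  by_cases hv : v ∈ G.ends
  · rw [hx'.outgoingSum_eq hH1 hv (by simp [hα]), strength, hα, WithTop.untopD_coe]
  · rw [outgoingSum_eq_zero_of_notMem_ends hv, x'.2.2.2 v (.inr hv), mul_zero]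

theorem IsEigenvalue.exists_energyForm_eq {μ : ℝ} (h : G.IsEigenvalue μ) :
    ∃ x : G.formDomain, 0 < G.massForm x x ∧ G.energyForm x x = μ * G.massForm x x := by
  classical
  obtain ⟨f, f', f'', ⟨hf, φ, hφ, hφD, hφα⟩, hne, heq⟩ := h
  let x : G.formDomain := ⟨(f, f', fun v => if v ∈ G.ends then φ v else 0),
    fun e => (hf e).isH1, fun e => by simp [G.src_mem_ends, G.tgt_mem_ends, hφ e],
    fun v hv => by rcases hv with hv | hv <;> simp [hv, hφD]⟩
  refine ⟨x, massForm_pos hne, ?_⟩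
  rw [← sub_eq_zero, energyForm_sub_mul_massForm_eq_sum (fun e => (hf e).isH1_deriv) heq]
  refine Finset.sum_eq_zero fun v hv => ?_
  by_cases hvD : G.coupling v = ⊤
  · rw [x.2.2.2 v (.inl hvD), mul_zero]
  · obtain ⟨α, hα⟩ := WithTop.ne_top_iff_exists.1 hvD
    simp [x, hv, hφα v α hα.symm, strength, ← hα]

theorem exists_value_ne_zero {x : G.formDomain} (h : 0 < G.massForm x x) :
    ∃ e, ∃ t ∈ Icc (G.lo e) (G.hi e), x.1.1 e t ≠ 0 := by
  by_contra! h0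
  rw [massForm_apply] at h
  refine h.ne' (Finset.sum_eq_zero fun e _ => ?_)
  rw [intervalIntegral.integral_congr (g := fun _ => 0) fun t ht => ?_,
    intervalIntegral.integral_zero]
  rw [uIcc_of_le (G.lo_lt_hi e).le] at ht
  simp only [h0 e t ht, mul_zero]

theorem isLeast_eigenvalues_of_isMinimizer {μ : ℝ} {x : G.formDomain} (hpos : 0 < G.massForm x x)
    (hμ : ∀ y, μ * G.massForm y y ≤ G.energyForm y y)
    (hx : G.energyForm x x = μ * G.massForm x x) : IsLeast G.eigenvalues μ := by
  refine ⟨(isWeakSolution_of_forall_mul_massForm_le hμ hx).isEigenvalue (exists_value_ne_zero hpos),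
    fun ρ hρ => ?_⟩
  obtain ⟨y, hypos, hy⟩ := hρ.exists_energyForm_eq
  exact le_of_mul_le_mul_right ((hμ y).trans_eq hy) hypos

section GroundState

variable [Finite V] [Nonempty E] (G)

theorem exists_isLeast_eigenvalues : ∃ μ, IsLeast G.eigenvalues μ ∧
    (∀ y, μ * G.massForm y y ≤ G.energyForm y y) ∧
    ∃ x, 0 < G.massForm x x ∧ G.energyForm x x = μ * G.massForm x x := by
  obtain ⟨x, hpos, hmin⟩ := G.exists_minimizer
  have hx := (div_mul_cancel₀ (G.energyForm x x) hpos.ne').symm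
  have hμ : ∀ y, G.energyForm x x / G.massForm x x * G.massForm y y ≤ G.energyForm y y :=
    fun y => by
      rw [div_mul_eq_mul_div, div_le_iff₀ hpos]
      exact hmin y
  exact ⟨_, isLeast_eigenvalues_of_isMinimizer hpos hμ hx, hμ, x, hpos, hx⟩

theorem isLeast_groundEnergy : IsLeast G.eigenvalues G.groundEnergy := by
  obtain ⟨μ, hμ, -⟩ := G.exists_isLeast_eigenvalues
  rwa [groundEnergy, hμ.csInf_eq]

variable {G} in
theorem groundEnergy_mul_massForm_le (y : G.formDomain) :
    G.groundEnergy * G.massForm y y ≤ G.energyForm y y := by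
  obtain ⟨μ, hμ, hmin, -⟩ := G.exists_isLeast_eigenvalues
  rw [groundEnergy, hμ.csInf_eq]
  exact hmin y

theorem exists_energyForm_eq_groundEnergy_mul : ∃ x, 0 < G.massForm x x ∧
    G.energyForm x x = G.groundEnergy * G.massForm x x := by
  obtain ⟨μ, hμ, -, hx⟩ := G.exists_isLeast_eigenvalues
  rwa [groundEnergy, hμ.csInf_eq]

end GroundState

end QuantumGraph

/-! ### Composition with contractions -/

/-- The soft threshold `r ↦ sign r * max (|r| - η) 0`, a contraction of the line that maps the
interval `[-η, η]` to zero. -/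
noncomputable def softThreshold (η r : ℝ) : ℝ := max (r - η) (min (r + η) 0)

theorem lipschitzWith_softThreshold (η : ℝ) : LipschitzWith 1 (softThreshold η) := by
  have h₁ : LipschitzWith 1 fun r : ℝ => r - η :=
    LipschitzWith.of_dist_le_mul fun r s => by simp
  have h₂ : LipschitzWith 1 fun r : ℝ => r + η := (isometry_add_right η).lipschitz
  exact max_self (1 : NNReal) ▸ h₁.max (h₂.min_const 0)

theorem softThreshold_eq_zero {η r : ℝ} (h : |r| ≤ η) : softThreshold η r = 0 := by
  rw [abs_le] at h
  rw [softThreshold, min_eq_right (by linarith), max_eq_right (by linarith)]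

theorem abs_softThreshold_mul_self_sub_le {η : ℝ} (hη : 0 ≤ η) (r : ℝ) :
    |softThreshold η r * softThreshold η r - r * r| ≤ 2 * η * |r| := by
  rcases le_total |r| η with h | h
  · rw [softThreshold_eq_zero h, zero_mul, zero_sub, abs_neg, abs_mul]
    nlinarith [abs_nonneg r]
  rcases abs_cases r with ⟨hr, _⟩ | ⟨hr, _⟩
  · rw [softThreshold, min_eq_right (by linarith), max_eq_left (by linarith), hr, abs_le]
    constructor <;> nlinarith
  · rw [softThreshold, min_eq_left (by linarith), max_eq_right (by linarith), hr, abs_le]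
    constructor <;> nlinarith

namespace QuantumGraph

variable {V E : Type*} [Fintype E] {G : QuantumGraph V E}

theorem energyForm_sub_mul_massForm_self (Λ : ℝ) (x : G.formDomain) :
    G.energyForm x x - Λ * G.massForm x x = G.dirichletForm x x +
      ∑ e, (∫ t in (G.lo e)..(G.hi e), (G.pot e t - Λ) * (x.1.1 e t * x.1.1 e t)) +
      ∑ v ∈ G.ends, G.strength v * (x.1.2.2 v * x.1.2.2 v) := by
  have hedge : ∀ e, ∫ t in (G.lo e)..(G.hi e), (G.pot e t - Λ) * (x.1.1 e t * x.1.1 e t) =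
      (∫ t in (G.lo e)..(G.hi e), G.pot e t * x.1.1 e t * x.1.1 e t) -
      Λ * ∫ t in (G.lo e)..(G.hi e), x.1.1 e t * x.1.1 e t := fun e => by
    rw [← intervalIntegral.integral_const_mul, ← intervalIntegral.integral_sub
      (intervalIntegrable_pot_mul_value_mul_value x x e)
      ((intervalIntegrable_value_mul_value x x e).const_mul Λ)]
    congr 1 with t
    ring
  simp only [hedge, Finset.sum_sub_distrib, ← Finset.mul_sum]
  rw [energyForm_apply, vertexForm_apply, potentialForm_apply, massForm_apply]
  ring

section LipschitzComp

variable {φ : ℝ → ℝ}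

/-- The composition of an element of the form domain with a contraction that fixes zero. -/
noncomputable def lipschitzComp (hφ : LipschitzWith 1 φ) (h0 : φ 0 = 0) (x : G.formDomain) :
    G.formDomain :=
  ⟨(fun e t => φ (x.1.1 e t), fun e => deriv fun t => φ (x.1.1 e t), fun v => φ (x.1.2.2 v)),
    fun e => (x.2.1 e).lipschitz_comp (G.lo_lt_hi e).le hφ,
    fun e => ⟨congrArg φ (x.2.2.1 e).1, congrArg φ (x.2.2.1 e).2⟩,
    fun v hv => (congrArg φ (x.2.2.2 v hv)).trans h0⟩

theorem dirichletForm_lipschitzComp_le (hφ : LipschitzWith 1 φ) (h0 : φ 0 = 0)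
    (x : G.formDomain) :
    G.dirichletForm (lipschitzComp hφ h0 x) (lipschitzComp hφ h0 x) ≤ G.dirichletForm x x := by
  rw [dirichletForm_apply, dirichletForm_apply]
  refine Finset.sum_le_sum fun e _ => intervalIntegral.integral_mono_ae_restrict (G.lo_lt_hi e).le
    (intervalIntegrable_deriv_mul_deriv _ _ e) (intervalIntegrable_deriv_mul_deriv x x e) ?_
  filter_upwards [(x.2.1 e).ae_abs_deriv_lipschitz_comp_le (G.lo_lt_hi e).le hφ] with t ht
  exact abs_le_iff_mul_self_le.1 ht

theorem massForm_lipschitzComp_abs (x : G.formDomain) :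
    G.massForm (lipschitzComp lipschitzWith_one_norm norm_zero x)
      (lipschitzComp lipschitzWith_one_norm norm_zero x) = G.massForm x x := by
  simp only [massForm_apply, lipschitzComp, Real.norm_eq_abs, abs_mul_abs_self]

theorem energyForm_lipschitzComp_abs_le (x : G.formDomain) :
    G.energyForm (lipschitzComp lipschitzWith_one_norm norm_zero x)
      (lipschitzComp lipschitzWith_one_norm norm_zero x) ≤ G.energyForm x x := by
  have h := dirichletForm_lipschitzComp_le lipschitzWith_one_norm norm_zero x
  simp only [energyForm_apply, potentialForm_apply, vertexForm_apply, lipschitzComp,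
    Real.norm_eq_abs, mul_assoc, abs_mul_abs_self] at h ⊢
  gcongr

theorem exists_forall_energyForm_softThreshold_le (Λ : ℝ) (x : G.formDomain) :
    ∃ K, ∀ η > 0, ∃ y : G.formDomain, (∀ e t, y.1.1 e t = softThreshold η (x.1.1 e t)) ∧
      G.energyForm y y - Λ * G.massForm y y ≤ G.energyForm x x - Λ * G.massForm x x + K * η := by
  refine ⟨∑ e, (∫ t in (G.lo e)..(G.hi e), |G.pot e t - Λ| * (2 * |x.1.1 e t|)) +
    ∑ v ∈ G.ends, |G.strength v| * (2 * |x.1.2.2 v|), fun η hη => ?_⟩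
  set T := softThreshold η
  have hbound : ∀ q r, q * (T r * T r) ≤ q * (r * r) + |q| * (2 * |r|) * η := fun q r => by
    have h := mul_le_mul_of_nonneg_left (abs_softThreshold_mul_self_sub_le hη.le r) (abs_nonneg q)
    rw [← abs_mul] at h
    linarith [le_abs_self (q * (T r * T r - r * r))]
  have hT := lipschitzWith_softThreshold η
  have hT0 : T 0 = 0 := softThreshold_eq_zero (abs_zero.trans_le hη.le)
  refine ⟨lipschitzComp hT hT0 x, fun _ _ => rfl, ?_⟩
  have hpot : ∀ (y : G.formDomain) e, IntervalIntegrable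
      (fun t => (G.pot e t - Λ) * (y.1.1 e t * y.1.1 e t)) volume (G.lo e) (G.hi e) :=
    fun y e => ((intervalIntegrable_pot_mul_value_mul_value y y e).sub
      ((intervalIntegrable_value_mul_value y y e).const_mul Λ)).congr fun t _ => by ring
  have herr : ∀ e, IntervalIntegrable (fun t => |G.pot e t - Λ| * (2 * |x.1.1 e t|)) volume
      (G.lo e) (G.hi e) := fun e => by
    have h := intervalIntegrable_of_memLp_two (G.lo_lt_hi e).le
      ((memLp_value x e).mul ((G.memLp_top_pot e).sub (memLp_const Λ)))
    exact (h.abs.const_mul 2).congr fun t _ => by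
      rw [Pi.mul_apply, Pi.sub_apply, abs_mul]
      ring
  rw [energyForm_sub_mul_massForm_self, energyForm_sub_mul_massForm_self, add_mul, Finset.sum_mul,
    Finset.sum_mul, add_add_add_comm, add_assoc (G.dirichletForm x x), ← Finset.sum_add_distrib,
    ← Finset.sum_add_distrib]
  refine add_le_add (add_le_add (dirichletForm_lipschitzComp_le hT hT0 x)
    (Finset.sum_le_sum fun e _ => ?_)) (Finset.sum_le_sum fun v _ => hbound _ _)
  rw [← intervalIntegral.integral_mul_const,
    ← intervalIntegral.integral_add (hpot x e) ((herr e).mul_const η)]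
  exact intervalIntegral.integral_mono (G.lo_lt_hi e).le (hpot _ e)
    ((hpot x e).add ((herr e).mul_const η)) fun t => hbound _ _

end LipschitzComp

end QuantumGraph

/-! ### Unique continuation -/

namespace QuantumGraph

variable {V E : Type*} {G : QuantumGraph V E}

theorem Connected.induction (hG : G.Connected) {X : E → Prop}
    (hX : ∀ e e', G.Linked e e' → X e → X e') {e : E} (he : X e) (e' : E) : X e' := by
  have hiff : ∀ e e', Relation.EqvGen G.Linked e e' → (X e ↔ X e') := fun e e' h => by
    induction h with
    | rel e e' h =>
      obtain ⟨v, hv, hev, hev'⟩ := h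
      exact ⟨hX e e' ⟨v, hv, hev, hev'⟩, hX e' e ⟨v, hv, hev', hev⟩⟩
    | refl => exact Iff.rfl
    | symm _ _ _ ih => exact ih.symm
    | trans _ _ _ _ _ ih ih' => exact ih.trans ih'
  exact (hiff e e' (hG e e')).1 he

section UniqueContinuation

variable [Fintype E] {μ : ℝ} {x : G.formDomain}

theorem eqOn_zero_of_isH1_deriv {e : E}
    (hx : IsH1 (G.lo e) (G.hi e) (x.1.2.1 e) fun t => (G.pot e t - μ) * x.1.1 e t) {t : ℝ}
    (ht : t ∈ Icc (G.lo e) (G.hi e)) (h0 : x.1.1 e t = 0) (h0' : x.1.2.1 e t = 0) :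
    EqOn (x.1.1 e) 0 (Icc (G.lo e) (G.hi e)) := by
  have hle := (G.lo_lt_hi e).le
  obtain ⟨M, hM⟩ := G.pot_bounded e
  have hbound : ∀ᵐ s ∂(volume.restrict (Icc (G.lo e) (G.hi e))),
      |(G.pot e s - μ) * x.1.1 e s| ≤ (M + |μ|) * |x.1.1 e s| := by
    refine (ae_restrict_iff' measurableSet_Icc).2 (.of_forall fun s hs => ?_)
    rw [abs_mul]
    gcongr
    exact (abs_sub _ _).trans (add_le_add_left (hM s hs) _)
  exact fun s hs => (((x.2.1 e).isAC hle).eq_zero_of_eq_zero_at (hx.isAC hle) hbound ht h0 h0' s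
    hs).1

theorem vertex_eq_zero_of_eqOn_zero {e : E} (he : EqOn (x.1.1 e) 0 (Icc (G.lo e) (G.hi e))) {v : V}
    (hv : G.src e = v ∨ G.tgt e = v) : x.1.2.2 v = 0 := by
  rcases hv with rfl | rfl
  · exact (x.2.2.1 e).1.symm.trans (he (left_mem_Icc.2 (G.lo_lt_hi e).le))
  · exact (x.2.2.1 e).2.symm.trans (he (right_mem_Icc.2 (G.lo_lt_hi e).le))

-- At a zero of a nonnegative solution all outgoing derivatives are nonnegative, so the vertex
-- condition forces each of them to vanish.
theorem IsWeakSolution.eqOn_zero_of_vertex_eq_zero (h : IsWeakSolution μ x)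
    (hx : ∀ e, IsH1 (G.lo e) (G.hi e) (x.1.2.1 e) fun t => (G.pot e t - μ) * x.1.1 e t)
    (hnonneg : ∀ e, ∀ t ∈ Icc (G.lo e) (G.hi e), 0 ≤ x.1.1 e t) {v : V} (hvD : G.coupling v ≠ ⊤)
    (hv : x.1.2.2 v = 0) {e : E} (he : G.src e = v ∨ G.tgt e = v) :
    EqOn (x.1.1 e) 0 (Icc (G.lo e) (G.hi e)) := by
  classical
  have hlo := fun e => left_mem_Icc.2 (G.lo_lt_hi e).le
  have hhi := fun e => right_mem_Icc.2 (G.lo_lt_hi e).le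
  have hmin : ∀ e, ∀ s ∈ Icc (G.lo e) (G.hi e), ∀ t ∈ Icc (G.lo e) (G.hi e), x.1.1 e s = 0 →
      0 ≤ x.1.2.1 e s * (t - s) := fun e s hs t ht h0 =>
    ((x.2.1 e).isAC (G.lo_lt_hi e).le).deriv_mul_sub_nonneg_of_isMinOn (hx e).continuousOn hs ht
      fun r hr => h0.trans_le (hnonneg e r hr)
  have hsrc : ∀ e, G.src e = v → x.1.1 e (G.lo e) = 0 ∧ 0 ≤ x.1.2.1 e (G.lo e) := fun e he => by
    have h0 : x.1.1 e (G.lo e) = 0 := by rw [(x.2.2.1 e).1, he, hv]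
    exact ⟨h0, nonneg_of_mul_nonneg_left (hmin e _ (hlo e) _ (hhi e) h0)
      (sub_pos.2 (G.lo_lt_hi e))⟩
  have htgt : ∀ e, G.tgt e = v → x.1.1 e (G.hi e) = 0 ∧ 0 ≤ -x.1.2.1 e (G.hi e) := fun e he => by
    have h0 : x.1.1 e (G.hi e) = 0 := by rw [(x.2.2.1 e).2, he, hv]
    refine ⟨h0, nonneg_of_mul_nonneg_left ?_ (sub_pos.2 (G.lo_lt_hi e))⟩
    linarith [hmin e _ (hhi e) _ (hlo e) h0]
  have hsum := h.outgoingSum_eq hx (G.mem_ends.2 ⟨e, he⟩) hvD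
  have hsrc_nonneg : ∀ e, 0 ≤ if G.src e = v then x.1.2.1 e (G.lo e) else 0 := fun e => by
    split_ifs with he
    exacts [(hsrc e he).2, le_rfl]
  have htgt_nonneg : ∀ e, 0 ≤ if G.tgt e = v then -x.1.2.1 e (G.hi e) else 0 := fun e => by
    split_ifs with he
    exacts [(htgt e he).2, le_rfl]
  rw [hv, mul_zero, outgoingSum, Finset.sum_eq_zero_iff_of_nonneg fun e _ =>
    add_nonneg (hsrc_nonneg e) (htgt_nonneg e)] at hsum
  have hterm := (add_eq_zero_iff_of_nonneg (hsrc_nonneg e) (htgt_nonneg e)).1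
    (hsum e (Finset.mem_univ e))
  rcases he with he | he
  · exact eqOn_zero_of_isH1_deriv (hx e) (hlo e) (hsrc e he).1 (by simpa [he] using hterm.1)
  · exact eqOn_zero_of_isH1_deriv (hx e) (hhi e) (htgt e he).1 (by simpa [he] using hterm.2)

theorem IsWeakSolution.eqOn_zero_of_nonneg (hG : G.Connected) (h : IsWeakSolution μ x)
    (hnonneg : ∀ e, ∀ t ∈ Icc (G.lo e) (G.hi e), 0 ≤ x.1.1 e t) {e : E} {t : ℝ}
    (ht : t ∈ Ioo (G.lo e) (G.hi e)) (h0 : x.1.1 e t = 0) (e' : E) :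
    EqOn (x.1.1 e') 0 (Icc (G.lo e') (G.hi e')) := by
  obtain ⟨x', hx', hvalue, -, hH1⟩ := h.exists_isH1_deriv
  rw [← hvalue] at hH1 hnonneg h0 ⊢
  have htI := Ioo_subset_Icc_self ht
  have hmin : ∀ s ∈ Icc (G.lo e) (G.hi e), 0 ≤ x'.1.2.1 e t * (s - t) := fun s hs =>
    ((x'.2.1 e).isAC (G.lo_lt_hi e).le).deriv_mul_sub_nonneg_of_isMinOn (hH1 e).continuousOn htI hs
      fun r hr => h0.trans_le (hnonneg e r hr)
  have hderiv : x'.1.2.1 e t = 0 := by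
    have h₁ := hmin _ (left_mem_Icc.2 (G.lo_lt_hi e).le)
    have h₂ := hmin _ (right_mem_Icc.2 (G.lo_lt_hi e).le)
    exact le_antisymm (by nlinarith [ht.1]) (by nlinarith [ht.2])
  refine hG.induction (X := fun e => EqOn (x'.1.1 e) 0 (Icc (G.lo e) (G.hi e)))
    (fun e e' ⟨v, hvD, he, he'⟩ hzero => ?_) (eqOn_zero_of_isH1_deriv (hH1 e) htI h0 hderiv) e'
  exact hx'.eqOn_zero_of_vertex_eq_zero hH1 hnonneg hvD (vertex_eq_zero_of_eqOn_zero hzero he) he'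

end UniqueContinuation

end QuantumGraph

/-! ### Trimming at Dirichlet ends -/

namespace QuantumGraph

variable {V E : Type*} {G G' : QuantumGraph V E}

/-- `G'` arises from `G` by cutting off pieces of edges at ends that carry the Dirichlet condition,
the new ends again carrying the Dirichlet condition. The combinatorial structure is unchanged, so
both graphs are indexed by the same vertices and edges. -/
structure IsTrimming (G' G : QuantumGraph V E) : Prop where
  src : G'.src = G.src
  tgt : G'.tgt = G.tgt
  pot : G'.pot = G.pot
  coupling : G'.coupling = G.coupling
  lo_le : ∀ e, G.lo e ≤ G'.lo e
  le_hi : ∀ e, G'.hi e ≤ G.hi e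
  coupling_src : ∀ e, G.lo e < G'.lo e → G.coupling (G.src e) = ⊤
  coupling_tgt : ∀ e, G'.hi e < G.hi e → G.coupling (G.tgt e) = ⊤

theorem eqOn_indicator_Icc {f : ℝ → ℝ} {a b c d : ℝ} (hleft : c < a → EqOn f 0 (Icc c a))
    (hright : b < d → EqOn f 0 (Icc b d)) : EqOn f ((Icc a b).indicator f) (Icc c d) := by
  intro t ht
  by_cases htI : t ∈ Icc a b
  · exact (indicator_of_mem htI _).symm
  rw [indicator_of_notMem htI]
  rcases not_and_or.1 htI with hlt | hlt <;> rw [not_le] at hlt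
  · exact hleft (ht.1.trans_lt hlt) ⟨ht.1, hlt.le⟩
  · exact hright (hlt.trans_le ht.2) ⟨hlt.le, ht.2⟩

namespace IsTrimming

theorem Icc_subset (h : G'.IsTrimming G) (e : E) :
    Icc (G'.lo e) (G'.hi e) ⊆ Icc (G.lo e) (G.hi e) :=
  Icc_subset_Icc (h.lo_le e) (h.le_hi e)

theorem integral_eq (h : G'.IsTrimming G) (e : E) {f g : ℝ → ℝ}
    (hfg : EqOn f ((Icc (G'.lo e) (G'.hi e)).indicator g) (Icc (G.lo e) (G.hi e))) :
    ∫ t in (G.lo e)..(G.hi e), f t = ∫ t in (G'.lo e)..(G'.hi e), g t := by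
  rw [intervalIntegral.integral_of_le (G.lo_lt_hi e).le,
    intervalIntegral.integral_of_le (G'.lo_lt_hi e).le, ← integral_Icc_eq_integral_Ioc,
    ← integral_Icc_eq_integral_Ioc, setIntegral_congr_fun measurableSet_Icc hfg,
    setIntegral_indicator measurableSet_Icc, inter_eq_right.2 (h.Icc_subset e)]

theorem exists_mem_Ioo_notMem_Icc (h : G'.IsTrimming G) {e : E}
    (he : G.lo e < G'.lo e ∨ G'.hi e < G.hi e) :
    ∃ t ∈ Ioo (G.lo e) (G.hi e), t ∉ Icc (G'.lo e) (G'.hi e) := by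
  rcases he with he | he
  · obtain ⟨t, hlt, hlt'⟩ := exists_between he
    exact ⟨t, ⟨hlt, hlt'.trans_le ((G'.lo_lt_hi e).le.trans (h.le_hi e))⟩,
      fun ht => hlt'.not_ge ht.1⟩
  · obtain ⟨t, hlt, hlt'⟩ := exists_between he
    exact ⟨t, ⟨((h.lo_le e).trans (G'.lo_lt_hi e).le).trans_lt hlt, hlt'⟩,
      fun ht => hlt.not_ge ht.2⟩

variable [Fintype E]

theorem ends_eq (h : G'.IsTrimming G) : G'.ends = G.ends := by
  rw [ends, ends, h.src, h.tgt]

theorem massForm_eq (h : G'.IsTrimming G) {x : G.formDomain} {z : G'.formDomain}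
    (hxz : ∀ e, EqOn (x.1.1 e) ((Icc (G'.lo e) (G'.hi e)).indicator (z.1.1 e))
      (Icc (G.lo e) (G.hi e))) :
    G.massForm x x = G'.massForm z z :=
  Finset.sum_congr rfl fun e _ => h.integral_eq e fun t ht => by
    rw [indicator_mul]
    exact congrArg₂ (· * ·) (hxz e ht) (hxz e ht)

theorem potentialForm_eq (h : G'.IsTrimming G) {x : G.formDomain} {z : G'.formDomain}
    (hxz : ∀ e, EqOn (x.1.1 e) ((Icc (G'.lo e) (G'.hi e)).indicator (z.1.1 e))
      (Icc (G.lo e) (G.hi e))) :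
    G.potentialForm x x = G'.potentialForm z z := by
  rw [potentialForm_apply, potentialForm_apply]
  refine Finset.sum_congr rfl fun e _ => h.integral_eq e fun t ht => ?_
  simp only [hxz e ht, h.pot, indicator_apply]
  split_ifs <;> simp

theorem vertexForm_eq (h : G'.IsTrimming G) {x : G.formDomain} {z : G'.formDomain}
    (hxz : x.1.2.2 = z.1.2.2) : G.vertexForm x x = G'.vertexForm z z := by
  simp only [vertexForm_apply, hxz, h.ends_eq, strength, h.coupling]

/-- Extension by zero of an element of the form domain of a trimmed graph. -/
noncomputable def extend (h : G'.IsTrimming G) (z : G'.formDomain) : G.formDomain :=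
  ⟨(fun e => (Icc (G'.lo e) (G'.hi e)).indicator (z.1.1 e),
    fun e => (Icc (G'.lo e) (G'.hi e)).indicator (z.1.2.1 e), z.1.2.2), by
    have hsrc : ∀ e, G.lo e < G'.lo e → z.1.2.2 (G.src e) = 0 := fun e he =>
      z.2.2.2 _ (.inl (by rw [h.coupling, h.coupling_src e he]))
    have htgt : ∀ e, G'.hi e < G.hi e → z.1.2.2 (G.tgt e) = 0 := fun e he =>
      z.2.2.2 _ (.inl (by rw [h.coupling, h.coupling_tgt e he]))
    have hlo : ∀ e, z.1.1 e (G'.lo e) = z.1.2.2 (G.src e) := fun e => by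
      rw [(z.2.2.1 e).1, h.src]
    have hhi : ∀ e, z.1.1 e (G'.hi e) = z.1.2.2 (G.tgt e) := fun e => by
      rw [(z.2.2.1 e).2, h.tgt]
    refine ⟨fun e => (z.2.1 e).indicator (G'.lo_lt_hi e).le (h.lo_le e) (h.le_hi e)
      (fun he => (hlo e).trans (hsrc e he)) (fun he => (hhi e).trans (htgt e he)),
      fun e => ⟨?_, ?_⟩, fun v hv => z.2.2.2 v (by rwa [h.coupling, h.ends_eq])⟩
    · rcases (h.lo_le e).lt_or_eq with he | he
      · exact (indicator_of_notMem (fun hmem => he.not_ge hmem.1) _).trans (hsrc e he).symm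
      · rw [he, ← hlo e]
        exact indicator_of_mem (left_mem_Icc.2 (G'.lo_lt_hi e).le) _
    · rcases (h.le_hi e).lt_or_eq with he | he
      · exact (indicator_of_notMem (fun hmem => he.not_ge hmem.2) _).trans (htgt e he).symm
      · rw [← he, ← hhi e]
        exact indicator_of_mem (right_mem_Icc.2 (G'.lo_lt_hi e).le) _⟩

theorem massForm_extend (h : G'.IsTrimming G) (z : G'.formDomain) :
    G.massForm (h.extend z) (h.extend z) = G'.massForm z z :=
  h.massForm_eq fun _ _ _ => rfl

theorem energyForm_extend (h : G'.IsTrimming G) (z : G'.formDomain) :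
    G.energyForm (h.extend z) (h.extend z) = G'.energyForm z z := by
  have hdirichlet : G.dirichletForm (h.extend z) (h.extend z) = G'.dirichletForm z z := by
    rw [dirichletForm_apply, dirichletForm_apply]
    exact Finset.sum_congr rfl fun e _ => h.integral_eq e fun t _ =>
      congrFun (indicator_mul ..).symm t
  rw [energyForm_apply, energyForm_apply, hdirichlet, h.potentialForm_eq fun _ _ _ => rfl,
    h.vertexForm_eq rfl]

/-- Restriction to a trimmed graph of an element of the form domain that vanishes on the pieces that
have been cut off. -/
def restrict (h : G'.IsTrimming G) (x : G.formDomain)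
    (hsrc : ∀ e, G.lo e < G'.lo e → EqOn (x.1.1 e) 0 (Icc (G.lo e) (G'.lo e)))
    (htgt : ∀ e, G'.hi e < G.hi e → EqOn (x.1.1 e) 0 (Icc (G'.hi e) (G.hi e))) :
    G'.formDomain :=
  ⟨x.1, by
    refine ⟨fun e => (x.2.1 e).mono (h.lo_le e) (h.le_hi e), fun e => ⟨?_, ?_⟩,
      fun v hv => x.2.2.2 v (by rwa [← h.coupling, ← h.ends_eq])⟩
    · rw [h.src]
      rcases (h.lo_le e).lt_or_eq with he | he
      · exact (hsrc e he (right_mem_Icc.2 he.le)).trans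
          (x.2.2.2 _ (.inl (h.coupling_src e he))).symm
      · rw [← he, (x.2.2.1 e).1]
    · rw [h.tgt]
      rcases (h.le_hi e).lt_or_eq with he | he
      · exact (htgt e he (left_mem_Icc.2 he.le)).trans
          (x.2.2.2 _ (.inl (h.coupling_tgt e he))).symm
      · rw [he, (x.2.2.1 e).2]⟩

section Restrict

variable (h : G'.IsTrimming G) {x : G.formDomain}
  (hsrc : ∀ e, G.lo e < G'.lo e → EqOn (x.1.1 e) 0 (Icc (G.lo e) (G'.lo e)))
  (htgt : ∀ e, G'.hi e < G.hi e → EqOn (x.1.1 e) 0 (Icc (G'.hi e) (G.hi e)))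

theorem massForm_restrict :
    G'.massForm (h.restrict x hsrc htgt) (h.restrict x hsrc htgt) = G.massForm x x :=
  (h.massForm_eq fun e => eqOn_indicator_Icc (hsrc e) (htgt e)).symm

theorem energyForm_restrict_le :
    G'.energyForm (h.restrict x hsrc htgt) (h.restrict x hsrc htgt) ≤ G.energyForm x x := by
  have hdirichlet : G'.dirichletForm (h.restrict x hsrc htgt) (h.restrict x hsrc htgt) ≤
      G.dirichletForm x x := by
    rw [dirichletForm_apply, dirichletForm_apply]
    refine Finset.sum_le_sum fun e _ => intervalIntegral.integral_mono_interval (h.lo_le e)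
      (G'.lo_lt_hi e).le (h.le_hi e) (.of_forall fun t => mul_self_nonneg _)
      (intervalIntegrable_deriv_mul_deriv x x e)
  rw [energyForm_apply, energyForm_apply,
    ← h.potentialForm_eq (z := h.restrict x hsrc htgt)
      fun e => eqOn_indicator_Icc (hsrc e) (htgt e),
    ← h.vertexForm_eq (z := h.restrict x hsrc htgt) rfl]
  gcongr

end Restrict

theorem groundEnergy_le [Finite V] [Nonempty E] (h : G'.IsTrimming G) :
    G.groundEnergy ≤ G'.groundEnergy := by
  obtain ⟨z, hpos, hz⟩ := G'.exists_energyForm_eq_groundEnergy_mul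
  have hle := groundEnergy_mul_massForm_le (h.extend z)
  rw [h.massForm_extend, h.energyForm_extend, hz] at hle
  exact le_of_mul_le_mul_right hle hpos

-- Otherwise the extension by zero of a nonnegative ground state of `G'` would be a ground state of
-- `G` that vanishes on an open set.
theorem groundEnergy_lt [Finite V] (h : G'.IsTrimming G) (hG : G.Connected) {e : E}
    (he : G.lo e < G'.lo e ∨ G'.hi e < G.hi e) : G.groundEnergy < G'.groundEnergy := by
  have : Nonempty E := ⟨e⟩
  by_contra! hle
  obtain ⟨z, hpos, hz⟩ := G'.exists_energyForm_eq_groundEnergy_mul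
  set w := h.extend (lipschitzComp lipschitzWith_one_norm norm_zero z)
  have hmass : G.massForm w w = G'.massForm z z :=
    (h.massForm_extend _).trans (massForm_lipschitzComp_abs z)
  have henergy : G.energyForm w w = G.groundEnergy * G.massForm w w := by
    refine le_antisymm ?_ (groundEnergy_mul_massForm_le w)
    rw [h.energyForm_extend, hmass]
    refine (energyForm_lipschitzComp_abs_le z).trans ?_
    rw [hz]
    gcongr
  have hsol : IsWeakSolution G.groundEnergy w :=
    isWeakSolution_of_forall_mul_massForm_le groundEnergy_mul_massForm_le henergy
  obtain ⟨t, ht, htI⟩ := h.exists_mem_Ioo_notMem_Icc he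
  have hnonneg : ∀ e, ∀ t ∈ Icc (G.lo e) (G.hi e), 0 ≤ w.1.1 e t := fun _ _ _ =>
    indicator_nonneg (fun _ _ => norm_nonneg _) _
  obtain ⟨e', s, hs, hne⟩ := exists_value_ne_zero (hmass.symm ▸ hpos)
  exact hne (hsol.eqOn_zero_of_nonneg hG hnonneg ht (indicator_of_notMem htI _) e' hs)

end IsTrimming

open Filter Topology in
theorem eventually_forall_abs_le {f : ℝ → ℝ} {a b η : ℝ} (hab : a ≤ b)
    (hf : ContinuousOn f (Icc a b)) (hη : 0 < η) :
    ∀ᶠ δ in 𝓝[>] (0 : ℝ), (f a = 0 → ∀ t ∈ Icc a b, t ≤ a + δ → |f t| ≤ η) ∧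
      (f b = 0 → ∀ t ∈ Icc a b, b - δ ≤ t → |f t| ≤ η) := by
  obtain ⟨r, hr, hfr⟩ := Metric.uniformContinuousOn_iff.1
    (isCompact_Icc.uniformContinuousOn_of_continuous hf) η hη
  filter_upwards [Ioo_mem_nhdsGT hr] with δ hδ
  refine ⟨fun h0 t ht htδ => ?_, fun h0 t ht htδ => ?_⟩
  · have hdist : dist t a < r := by
      rw [Real.dist_eq, abs_lt]
      constructor <;> linarith [ht.1, hδ.2]
    simpa [h0, Real.dist_eq] using (hfr t ht a (left_mem_Icc.2 hab) hdist).le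
  · have hdist : dist t b < r := by
      rw [Real.dist_eq, abs_lt]
      constructor <;> linarith [ht.2, hδ.2]
    simpa [h0, Real.dist_eq] using (hfr t ht b (right_mem_Icc.2 hab) hdist).le

open Filter Topology in
-- Soft thresholding makes the ground state of `G` vanish near the Dirichlet ends, hence a trial
-- function on every trimming by a small amount.
theorem exists_forall_isTrimming_groundEnergy_lt [Fintype E] [Finite V] [Nonempty E] {Λ : ℝ}
    (hΛ : G.groundEnergy < Λ) :
    ∃ δ > 0, ∀ G' : QuantumGraph V E, G'.IsTrimming G → (∀ e, G'.lo e ≤ G.lo e + δ) →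
      (∀ e, G.hi e - δ ≤ G'.hi e) → G'.groundEnergy < Λ := by
  obtain ⟨x, hpos, hx⟩ := G.exists_energyForm_eq_groundEnergy_mul
  obtain ⟨K, hK⟩ := exists_forall_energyForm_softThreshold_le Λ x
  have hgap : G.energyForm x x - Λ * G.massForm x x < 0 := by
    rw [hx, ← sub_mul]
    exact mul_neg_of_neg_of_pos (sub_neg.2 hΛ) hpos
  obtain ⟨η, hη, hKη⟩ := exists_pos_mul_lt (neg_pos.2 hgap) K
  obtain ⟨y, hy, henergy⟩ := hK η hη
  have hsmall := eventually_all.2 fun e =>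
    eventually_forall_abs_le (G.lo_lt_hi e).le (continuousOn_value x e) hη
  obtain ⟨δ, hδ, hδpos⟩ := (hsmall.and self_mem_nhdsWithin).exists
  refine ⟨δ, hδpos, fun G' h hlo hhi => ?_⟩
  have hsrc : ∀ e, G.lo e < G'.lo e → EqOn (y.1.1 e) 0 (Icc (G.lo e) (G'.lo e)) :=
    fun e he t ht => (hy e t).trans (softThreshold_eq_zero ((hδ e).1
      ((x.2.2.1 e).1.trans (x.2.2.2 _ (.inl (h.coupling_src e he)))) t
      ⟨ht.1, ht.2.trans ((G'.lo_lt_hi e).le.trans (h.le_hi e))⟩ (ht.2.trans (hlo e))))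
  have htgt : ∀ e, G'.hi e < G.hi e → EqOn (y.1.1 e) 0 (Icc (G'.hi e) (G.hi e)) :=
    fun e he t ht => (hy e t).trans (softThreshold_eq_zero ((hδ e).2
      ((x.2.2.1 e).2.trans (x.2.2.2 _ (.inl (h.coupling_tgt e he)))) t
      ⟨(h.lo_le e).trans ((G'.lo_lt_hi e).le.trans ht.1), ht.2⟩ ((hhi e).trans ht.1)))
  set z := h.restrict y hsrc htgt
  have hz : G'.energyForm z z - Λ * G'.massForm z z < 0 := by
    rw [h.massForm_restrict]
    linarith [h.energyForm_restrict_le hsrc htgt]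
  by_contra! hcon
  nlinarith [groundEnergy_mul_massForm_le z, massForm_nonneg z]

end QuantumGraph

/-! ### Moving a partition vertex -/

theorem strictMono_update {ι α : Type*} [LinearOrder ι] [Preorder α] {f : ι → α} (hf : StrictMono f)
    {i : ι} {a : α} (hlt : ∀ j < i, f j < a) (hgt : ∀ j > i, a < f j) :
    StrictMono (Function.update f i a) := by
  intro j k hjk
  rcases eq_or_ne j i with rfl | hj
  · rw [Function.update_self, Function.update_of_ne hjk.ne']
    exact hgt k hjk
  rw [Function.update_of_ne hj]
  rcases eq_or_ne k i with rfl | hk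
  · rw [Function.update_self]
    exact hlt j hjk
  · rw [Function.update_of_ne hk]
    exact hf hjk

namespace QuantumGraph

theorem connected_subgraph {V E : Type*} (G : QuantumGraph V E) (c : G.Component) :
    (G.subgraph c).Connected := by
  have hchain : ∀ e e', Relation.EqvGen G.Linked e e' →
      ∀ (he : Quotient.mk G.linkSetoid e = c) (he' : Quotient.mk G.linkSetoid e' = c),
        Relation.EqvGen (G.subgraph c).Linked ⟨e, he⟩ ⟨e', he'⟩ := by
    intro e e' h
    induction h with
    | rel e e' h => exact fun _ _ => .rel _ _ h
    | refl => exact fun _ _ => .refl _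
    | symm _ _ _ ih => exact fun he he' => (ih he' he).symm
    | trans e e' e'' hee' _ ih ih' =>
      intro he he''
      have he' : Quotient.mk G.linkSetoid e' = c := (Quotient.sound hee'.symm).trans he
      exact (ih he he').trans _ _ _ (ih' he' he'')
  rintro ⟨e, he⟩ ⟨e', he'⟩
  exact hchain e e' (Quotient.exact (he.trans he'.symm)) he he'

namespace Partition

variable {V E : Type*} [Fintype E] {G : QuantumGraph V E} {m : ℕ} (P : G.Partition m)

/-- The segment that ends at a partition vertex. -/
def leftSegment (p : P.Vertex) : P.Segment := ⟨p.1, p.2.castSucc⟩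

/-- The segment that starts at a partition vertex. -/
def rightSegment (p : P.Vertex) : P.Segment := ⟨p.1, p.2.succ⟩

/-- The part of the partition that contains a segment. -/
def partOf (q : P.Segment) : P.Part := Quotient.mk P.divided.linkSetoid q

/-- The open interval between the neighbours of a partition vertex on its edge. -/
def interval (p : P.Vertex) : Set ℝ := Ioo (P.t p.1 p.2.castSucc.castSucc) (P.t p.1 p.2.succ.succ)

theorem pos_mem_interval (p : P.Vertex) : P.pos p ∈ P.interval p :=
  ⟨P.strictMono p.1 (Fin.castSucc_lt_castSucc_iff.2 Fin.castSucc_lt_succ),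
    P.strictMono p.1 Fin.castSucc_lt_succ⟩

open Classical in
/-- The partition obtained by moving the partition vertex `p` to the position `s` between its
neighbours. Since `n` is unchanged, it has the same segments and the same parts as `P`. -/
noncomputable abbrev move (p : P.Vertex) (s : ℝ) (hs : s ∈ P.interval p) : G.Partition m where
  n := P.n
  t := Function.update P.t p.1 (Function.update (P.t p.1) p.2.succ.castSucc s)
  strictMono e := by
    rcases eq_or_ne e p.1 with rfl | he
    · rw [Function.update_self]
      have hmono := P.strictMono p.1
      refine strictMono_update hmono (fun k hk => (hmono.monotone ?_).trans_lt hs.1)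
        fun k hk => hs.2.trans_le (hmono.monotone ?_)
      · rw [← Fin.succ_castSucc] at hk
        exact Fin.le_castSucc_iff.2 hk
      · exact Fin.castSucc_lt_iff_succ_le.1 hk
    · rw [Function.update_of_ne he]
      exact P.strictMono e
  t_zero e := by
    rcases eq_or_ne e p.1 with rfl | he
    · rw [Function.update_self, Function.update_of_ne, P.t_zero]
      exact (Fin.castSucc_pos_iff.2 (Fin.succ_pos _)).ne
    · rw [Function.update_of_ne he, P.t_zero]
  t_last e := by
    rcases eq_or_ne e p.1 with rfl | he
    · rw [Function.update_self, Function.update_of_ne (Fin.castSucc_lt_last _).ne', P.t_last]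
    · rw [Function.update_of_ne he, P.t_last]
  sum_n := P.sum_n

section Move

variable {p : P.Vertex} {s : ℝ} (hs : s ∈ P.interval p)

open Classical in
theorem pos_move (q : P.Vertex) :
    (P.move p s hs).pos q = if q = p then s else P.pos q := by
  obtain ⟨e, k⟩ := p
  obtain ⟨e', k'⟩ := q
  rcases eq_or_ne e' e with rfl | he
  · simp [pos, Function.update_apply]
  · simp [pos, he]

open Classical in
theorem lo_move (q : P.Segment) :
    (P.move p s hs).divided.lo q = if q = P.rightSegment p then s else P.divided.lo q := by
  obtain ⟨e, k⟩ := p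
  obtain ⟨e', k'⟩ := q
  rcases eq_or_ne e' e with rfl | he
  · simp [divided, rightSegment, Function.update_apply, -Fin.castSucc_succ]
  · simp [divided, rightSegment, he]

open Classical in
theorem hi_move (q : P.Segment) :
    (P.move p s hs).divided.hi q = if q = P.leftSegment p then s else P.divided.hi q := by
  obtain ⟨e, k⟩ := p
  obtain ⟨e', k'⟩ := q
  rcases eq_or_ne e' e with rfl | he
  · simp [divided, leftSegment, Function.update_apply]
  · simp [divided, leftSegment, he]

theorem coupling_src_of_lo_move_ne {q : P.Segment}
    (hq : (P.move p s hs).divided.lo q ≠ P.divided.lo q) :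
    P.divided.coupling (P.divided.src q) = ⊤ := by
  obtain rfl : q = P.rightSegment p := of_not_not fun h => hq ((P.lo_move hs q).trans (if_neg h))
  simp [divided, rightSegment]

theorem coupling_tgt_of_hi_move_ne {q : P.Segment}
    (hq : (P.move p s hs).divided.hi q ≠ P.divided.hi q) :
    P.divided.coupling (P.divided.tgt q) = ⊤ := by
  obtain rfl : q = P.leftSegment p := of_not_not fun h => hq ((P.hi_move hs q).trans (if_neg h))
  simp [divided, leftSegment]

theorem isNear_move {ε : ℝ} (hε : |s - P.pos p| < ε) : P.IsNear ε (P.move p s hs) := by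
  classical
  refine ⟨Equiv.refl _, fun q => ⟨rfl, ?_⟩⟩
  rw [Equiv.refl_apply, pos_move]
  split_ifs with hq
  · rwa [hq]
  · rw [sub_self, abs_zero]
    exact (abs_nonneg _).trans_lt hε

variable {j : P.Part}

theorem isTrimming_subgraph_move (hl : j = P.partOf (P.leftSegment p) → s ≤ P.pos p)
    (hr : j = P.partOf (P.rightSegment p) → P.pos p ≤ s) :
    IsTrimming (V := V ⊕ P.Vertex) (E := {q : P.Segment // Quotient.mk P.divided.linkSetoid q = j})
      ((P.move p s hs).divided.subgraph j) (P.divided.subgraph j) where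
  src := rfl
  tgt := rfl
  pot := rfl
  coupling := rfl
  lo_le := by
    rintro ⟨q, hq⟩
    refine le_of_le_of_eq ?_ (P.lo_move hs q).symm
    split_ifs with h
    exacts [h ▸ hr (by rw [← hq, h]; rfl), le_rfl]
  le_hi := by
    rintro ⟨q, hq⟩
    refine (P.hi_move hs q).trans_le ?_
    split_ifs with h
    exacts [h ▸ hl (by rw [← hq, h]; rfl), le_rfl]
  coupling_src _ hlt := P.coupling_src_of_lo_move_ne hs hlt.ne'
  coupling_tgt _ hlt := P.coupling_tgt_of_hi_move_ne hs hlt.ne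

theorem isTrimming_move_subgraph (hl : j = P.partOf (P.leftSegment p) → P.pos p ≤ s)
    (hr : j = P.partOf (P.rightSegment p) → s ≤ P.pos p) :
    IsTrimming (V := V ⊕ P.Vertex) (E := {q : P.Segment // Quotient.mk P.divided.linkSetoid q = j})
      (P.divided.subgraph j) ((P.move p s hs).divided.subgraph j) where
  src := rfl
  tgt := rfl
  pot := rfl
  coupling := rfl
  lo_le := by
    rintro ⟨q, hq⟩
    refine (P.lo_move hs q).trans_le ?_
    split_ifs with h
    exacts [h ▸ hr (by rw [← hq, h]; rfl), le_rfl]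
  le_hi := by
    rintro ⟨q, hq⟩
    refine le_of_le_of_eq ?_ (P.hi_move hs q).symm
    split_ifs with h
    exacts [h ▸ hl (by rw [← hq, h]; rfl), le_rfl]
  coupling_src _ hlt := P.coupling_src_of_lo_move_ne hs hlt.ne
  coupling_tgt _ hlt := P.coupling_tgt_of_hi_move_ne hs hlt.ne'

end Move

theorem nonempty_edges (j : P.Part) :
    Nonempty {q : P.Segment // Quotient.mk P.divided.linkSetoid q = j} := by
  obtain ⟨q, hq⟩ := Quotient.exists_rep j
  exact ⟨⟨q, hq⟩⟩

theorem isLeast_partEnergy [Finite V] (j : P.Part) :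
    IsLeast (P.partEigenvalues j) (P.partEnergy j) := by
  classical
  have := P.nonempty_edges j
  exact (P.divided.subgraph j).isLeast_groundEnergy

theorem partEnergy_le_energy (j : P.Part) : P.partEnergy j ≤ P.energy :=
  le_ciSup (finite_range P.partEnergy).bddAbove j

section PartEnergy

variable [Finite V] {p : P.Vertex} {s : ℝ} (hs : s ∈ P.interval p) {j : P.Part}

theorem partEnergy_move_of_ne (hl : j ≠ P.partOf (P.leftSegment p))
    (hr : j ≠ P.partOf (P.rightSegment p)) : (P.move p s hs).partEnergy j = P.partEnergy j := by
  classical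
  have := P.nonempty_edges j
  exact le_antisymm (P.isTrimming_move_subgraph hs hl.elim hr.elim).groundEnergy_le
    (P.isTrimming_subgraph_move hs hl.elim hr.elim).groundEnergy_le

theorem partEnergy_move_lt (hj : j = P.partOf (P.leftSegment p) ∨ j = P.partOf (P.rightSegment p))
    (hl : j = P.partOf (P.leftSegment p) → P.pos p < s)
    (hr : j = P.partOf (P.rightSegment p) → s < P.pos p) :
    (P.move p s hs).partEnergy j < P.partEnergy j := by
  classical
  have htrim := P.isTrimming_move_subgraph hs (fun h => (hl h).le) fun h => (hr h).le
  have hconn := (P.move p s hs).divided.connected_subgraph j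
  rcases hj with hj | hj
  · refine htrim.groundEnergy_lt hconn (e := ⟨P.leftSegment p, hj.symm⟩) (.inr ?_)
    exact (hl hj).trans_eq ((P.hi_move hs _).trans (if_pos rfl)).symm
  · refine htrim.groundEnergy_lt hconn (e := ⟨P.rightSegment p, hj.symm⟩) (.inl ?_)
    exact ((P.lo_move hs _).trans (if_pos rfl)).trans_lt (hr hj)

open Filter Topology in
theorem eventually_partEnergy_move_lt {Λ : ℝ} (hΛ : P.partEnergy j < Λ) :
    ∀ᶠ s in 𝓝 (P.pos p), ∀ hs : s ∈ P.interval p,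
      (j = P.partOf (P.leftSegment p) → s ≤ P.pos p) →
      (j = P.partOf (P.rightSegment p) → P.pos p ≤ s) → (P.move p s hs).partEnergy j < Λ := by
  classical
  have := P.nonempty_edges j
  obtain ⟨δ, hδ, hlt⟩ := exists_forall_isTrimming_groundEnergy_lt hΛ
  filter_upwards [Icc_mem_nhds (sub_lt_self (P.pos p) hδ) (lt_add_of_pos_right _ hδ)]
    with s hsδ hs hl hr
  refine hlt _ (P.isTrimming_subgraph_move hs hl hr) (fun ⟨q, hq⟩ => ?_) fun ⟨q, hq⟩ => ?_
  · refine (P.lo_move hs q).trans_le ?_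
    split_ifs with h
    exacts [h ▸ hsδ.2, le_add_of_nonneg_right hδ.le]
  · refine le_of_le_of_eq ?_ (P.hi_move hs q).symm
    split_ifs with h
    exacts [h ▸ hsδ.1, sub_le_self _ hδ.le]

end PartEnergy

end Partition

end QuantumGraph

/-! ### Decreasing the energy -/

namespace QuantumGraph

namespace Partition

variable {V E : Type*} [Fintype E] {G : QuantumGraph V E} {m : ℕ} (P : G.Partition m)

theorem exists_partOf_eq_of_linked {e e' : E} (h : G.Linked e e') :
    ∃ k k', P.partOf ⟨e, k⟩ = P.partOf ⟨e', k'⟩ := by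
  have hend : ∀ e v, (G.src e = v ∨ G.tgt e = v) → ∃ k : Fin (P.n e + 1),
      P.divided.src ⟨e, k⟩ = Sum.inl v ∨ P.divided.tgt ⟨e, k⟩ = Sum.inl v := by
    rintro e v (rfl | rfl)
    · exact ⟨0, .inl rfl⟩
    · exact ⟨Fin.last _, .inr (by simp [divided])⟩
  obtain ⟨v, hv, he, he'⟩ := h
  obtain ⟨k, hk⟩ := hend e v he
  obtain ⟨k', hk'⟩ := hend e' v he'
  exact ⟨k, k', Quotient.sound (.rel _ _ ⟨Sum.inl v, hv, hk, hk'⟩)⟩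

theorem exists_not_iff_of_connected (hG : G.Connected) {X : P.Part → Prop} {i j : P.Part}
    (hi : X i) (hj : ¬X j) :
    ∃ p, ¬(X (P.partOf (P.leftSegment p)) ↔ X (P.partOf (P.rightSegment p))) := by
  by_contra! hX
  have hedge : ∀ e k, X (P.partOf ⟨e, k⟩) ↔ X (P.partOf ⟨e, 0⟩) := fun e k => by
    induction k using Fin.induction with
    | zero => exact Iff.rfl
    | succ k ih => exact (hX ⟨e, k⟩).symm.trans ih
  obtain ⟨⟨e, k⟩, rfl⟩ := Quotient.exists_rep i
  obtain ⟨⟨e', k'⟩, rfl⟩ := Quotient.exists_rep j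
  refine hj ((hedge e' k').2 (hG.induction (X := fun e => X (P.partOf ⟨e, 0⟩))
    (fun e e' hee' he => ?_) ((hedge e k).1 hi) e'))
  obtain ⟨k, k', h⟩ := P.exists_partOf_eq_of_linked hee'
  exact (hedge e' k').1 (h ▸ (hedge e k).2 he)

open Filter Topology in
theorem exists_move_lt [Finite V] {p : P.Vertex}
    (hp : ¬(P.partEnergy (P.partOf (P.leftSegment p)) = P.energy ↔
      P.partEnergy (P.partOf (P.rightSegment p)) = P.energy)) {ε : ℝ} (hε : 0 < ε) :
    ∃ s, ∃ hs : s ∈ P.interval p, |s - P.pos p| < ε ∧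
      ∀ j, j = P.partOf (P.leftSegment p) ∨ j = P.partOf (P.rightSegment p) →
        (P.move p s hs).partEnergy j < P.energy := by
  have hne : P.partOf (P.leftSegment p) ≠ P.partOf (P.rightSegment p) := fun h => hp (by rw [h])
  have hnear : ∀ᶠ s in 𝓝 (P.pos p), s ∈ P.interval p ∧ |s - P.pos p| < ε :=
    .and (Ioo_mem_nhds (P.pos_mem_interval p).1 (P.pos_mem_interval p).2)
      (eventually_abs_sub_lt _ hε)
  by_cases hl : P.partEnergy (P.partOf (P.leftSegment p)) = P.energy
  · have hr := (P.partEnergy_le_energy _).lt_of_ne fun hr => hp (iff_of_true hl hr)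
    obtain ⟨s, ⟨⟨hs, hsε⟩, hlt⟩, hgt⟩ :=
      (((hnear.and (P.eventually_partEnergy_move_lt (p := p) hr)).filter_mono
        nhdsWithin_le_nhds).and (self_mem_nhdsWithin (s := Ioi (P.pos p)))).exists
    refine ⟨s, hs, hsε, ?_⟩
    rintro j (rfl | rfl)
    · exact (P.partEnergy_move_lt hs (.inl rfl) (fun _ => hgt) fun h => (hne h).elim).trans_eq hl
    · exact hlt hs (fun h => (hne h.symm).elim) fun _ => hgt.le
  · have hr : P.partEnergy (P.partOf (P.rightSegment p)) = P.energy :=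
      of_not_not fun hr => hp (iff_of_false hl hr)
    obtain ⟨s, ⟨⟨hs, hsε⟩, hlt⟩, hgt⟩ :=
      (((hnear.and (P.eventually_partEnergy_move_lt (p := p)
        ((P.partEnergy_le_energy _).lt_of_ne hl))).filter_mono
        nhdsWithin_le_nhds).and (self_mem_nhdsWithin (s := Iio (P.pos p)))).exists
    refine ⟨s, hs, hsε, ?_⟩
    rintro j (rfl | rfl)
    · exact hlt hs (fun _ => hgt.le) fun h => (hne h).elim
    · exact (P.partEnergy_move_lt hs (.inr rfl) (fun h => (hne h.symm).elim) fun _ =>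
        hgt).trans_eq hr

/-- The number of parts whose ground state energy is maximal. -/
noncomputable def numMaximal : ℕ := {j | P.partEnergy j = P.energy}.ncard

theorem exists_isNear_numMaximal_lt [Finite V] (hG : G.Connected)
    (hne : ∃ j, P.partEnergy j ≠ P.energy) {ε : ℝ} (hε : 0 < ε) :
    ∃ Q : G.Partition m, P.IsNear ε Q ∧ (∃ A, Q.partEnergy A < P.energy) ∧
      Q.energy ≤ P.energy ∧ (Q.energy = P.energy → Q.numMaximal < P.numMaximal) := by
  obtain ⟨j, hj⟩ := hne
  have : Nonempty P.Part := ⟨j⟩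
  obtain ⟨i, hi⟩ : ∃ i, P.partEnergy i = P.energy := exists_eq_ciSup_of_finite
  obtain ⟨p, hp⟩ := P.exists_not_iff_of_connected hG (X := fun j => P.partEnergy j = P.energy) hi hj
  obtain ⟨s, hs, hsε, hlt⟩ := P.exists_move_lt hp hε
  have hor : ∀ j, (P.move p s hs).partEnergy j = P.partEnergy j ∨
      (P.move p s hs).partEnergy j < P.energy := fun j => by
    by_cases hj : j = P.partOf (P.leftSegment p) ∨ j = P.partOf (P.rightSegment p)
    · exact .inr (hlt j hj)
    · exact .inl (P.partEnergy_move_of_ne hs (not_or.1 hj).1 (not_or.1 hj).2)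
  obtain ⟨A, hA, hA'⟩ : ∃ A, P.partEnergy A = P.energy ∧
      (P.move p s hs).partEnergy A < P.energy := by
    by_cases hl : P.partEnergy (P.partOf (P.leftSegment p)) = P.energy
    · exact ⟨_, hl, hlt _ (.inl rfl)⟩
    · exact ⟨_, of_not_not fun hr => hp (iff_of_false hl hr), hlt _ (.inr rfl)⟩
  have : Nonempty (P.move p s hs).Part := ⟨A⟩
  refine ⟨P.move p s hs, P.isNear_move hs hsε, ⟨A, hA'⟩, ciSup_le fun j => ?_, fun heq => ?_⟩
  · exact (hor j).elim (fun h => h.trans_le (P.partEnergy_le_energy j)) le_of_lt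
  · refine ncard_lt_ncard (t := {j : P.Part | P.partEnergy j = P.energy})
      ⟨fun j hj => ?_, fun hsub => ?_⟩ (toFinite _)
    · have hj' : (P.move p s hs).partEnergy j = P.energy := hj.trans heq
      exact (hor j).elim (fun h => h.symm.trans hj') fun h => (h.ne hj').elim
    · exact hA'.ne ((hsub hA).trans heq)

theorem IsNear.mono {P Q : G.Partition m} {ε ε' : ℝ} (h : P.IsNear ε Q) (hε : ε ≤ ε') :
    P.IsNear ε' Q := by
  obtain ⟨σ, hσ⟩ := h
  exact ⟨σ, fun p => ⟨(hσ p).1, (hσ p).2.trans_le hε⟩⟩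

theorem IsNear.trans {P Q R : G.Partition m} {ε ε' : ℝ} (h : P.IsNear ε Q) (h' : Q.IsNear ε' R) :
    P.IsNear (ε + ε') R := by
  obtain ⟨σ, hσ⟩ := h
  obtain ⟨τ, hτ⟩ := h'
  refine ⟨σ.trans τ, fun p => ⟨(hτ (σ p)).1.trans (hσ p).1, ?_⟩⟩
  calc |R.pos (τ (σ p)) - P.pos p|
    _ ≤ |R.pos (τ (σ p)) - Q.pos (σ p)| + |Q.pos (σ p) - P.pos p| := abs_sub_le _ _ _
    _ < ε' + ε := add_lt_add (hτ (σ p)).2 (hσ p).2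
    _ = ε + ε' := add_comm _ _

theorem isEquipartition_iff [Finite V] : P.IsEquipartition ↔ ∀ j, P.partEnergy j = P.energy := by
  refine ⟨fun ⟨μ, hμ⟩ j => ?_, fun h => ⟨P.energy, fun j => h j ▸ P.isLeast_partEnergy j⟩⟩
  have h : ∀ j, P.partEnergy j = μ := fun j => (P.isLeast_partEnergy j).unique (hμ j)
  have : Nonempty P.Part := ⟨j⟩
  rw [energy, h, funext h, ciSup_const]

end Partition

end QuantumGraph

theorem theorem1 {V E : Type*} [Finite V] [Fintype E] (G : QuantumGraph V E)
    (hG : G.Connected) (m : ℕ) (P : G.Partition m) (hP : P.IsLocalMinEnergy) :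
    P.IsEquipartition := by
  induction hn : P.numMaximal using Nat.strong_induction_on generalizing P with
  | _ n ih =>
  by_contra hne
  simp only [P.isEquipartition_iff, not_forall] at hne
  obtain ⟨ε, hε, hmin⟩ := hP
  obtain ⟨Q, hPQ, ⟨A, hA⟩, hle, hlt⟩ := P.exists_isNear_numMaximal_lt hG hne (half_pos hε)
  have henergy : Q.energy = P.energy := hle.antisymm (hmin Q (hPQ.mono (half_le_self hε.le)))
  have hQ : Q.IsLocalMinEnergy := ⟨ε / 2, half_pos hε, fun R hQR =>
    henergy.trans_le (hmin R (add_halves ε ▸ hPQ.trans hQR))⟩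
  have hQequi := Q.isEquipartition_iff.1 (ih _ (hn ▸ hlt henergy) Q hQ rfl)
  exact hA.ne ((hQequi A).trans henergy)
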